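/- **Definitions.** A function $f$ belongs to the Laguerre–Pólya class $\mathcal{L\text{-}P}$ if $$f(z)=c\,z^{d}e^{-\gamma z^{2}+\beta z}\prod_{j=1}^{\omega}\Bigl(1-\frac{z}{\alpha_j}\Bigr)e^{z/\alpha_j},\qquad 0\le\omega\le\infty,$$ where $c,\beta\in\mathbb{R}$, $\alpha_j\in\mathbb{R}\setminus\{0\}$, $\gamma\ge 0$, $d$ is a nonnegative integer and $\sum_j\alpha_j^{-2}<\infty$. A function $\varphi$ belongs to $\mathcal{L\text{-}P^*}$ if $\varphi=pf$, where $f\in\mathcal{L\text{-}P}$ and $p$ is a real polynomial without real zeros. Let $Z_{\mathbb{C}}(g)$ and $Z_{\mathbb{R}}(g)$ denote the numbers of nonreal and of real zeros of $g$, counted with multiplicities (a function that vanishes identically is regarded as having infinitely many zeros). Put $$Q=\Bigl(\frac{\varphi'}{\varphi}\Bigr)',\qquad Q_1=\Bigl(\frac{\varphi''}{\varphi'}\Bigr)'.$$ For a real zero $\alpha$ of $\varphi$, let $\beta_1<\alpha$ be the real zero of $\varphi'$ closest to $\alpha$ on the left ($\beta_1=-\infty$ if $\varphi'$ has no zeros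 in $(-\infty,\alpha)$) and let $\beta_2>\alpha$ be the real zero of $\varphi'$ closest to $\alpha$ on the right ($\beta_2=+\infty$ if $\varphi'$ has no zeros in $(\alpha,+\infty)$). The function $\varphi$ *possesses property A* if, for each of its real zeros $\alpha$, $Q$ has no zeros in at least one of the intervals $(\beta_1,\alpha)$ and $(\alpha,\beta_2)$; in particular, a function without real zeros possesses property A. **Theorem.** Let $\varphi\in\mathcal{L\text{-}P^*}$ be not of the form $Ce^{\beta z}$ with $C,\beta\in\mathbb{R}$, suppose that $\varphi$ has exactly $2m$ nonreal zeros, counted with multiplicities, and that $\varphi$ possesses property A. Then $\varphi'$ has a finite even number $2m_1=Z_{\mathbb{C}}(\varphi')$ of nonreal zeros, $Z_{\mathbb{R}}(Q)$ is finite, $Z_{\mathbb{R}}(Q_1)$ is finite unless $\varphi'$ is itself of the form $Ce^{\beta z}$ with $C,\beta\in\mathbb{R}$, and $$2m-2m_1\;\le\; Z_{\mathbb{R}}(Q)\;\le\; 2m-2m_1+Z_{\mathbb{R}}(Q_1).$$ -/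

import Mathlib

open Polynomial

noncomputable section

/-- The Laguerre-Polya class: all functions
`c * z ^ d * exp (-γ z² + β z) * ∏_{1 ≤ j ≤ ω} (1 - z / α_j) * exp (z / α_j)`, `0 ≤ ω ≤ ∞`,
with real `c`, `β`, real nonzero `α_j`, `γ ≥ 0`, and `∑ α_j⁻² < ∞`.
The factors are indexed here by the natural numbers `j < ω`. -/
def LaguerrePolya : Set (ℂ → ℂ) :=
  {f | ∃ (c β γ : ℝ) (d : ℕ) (ω : ℕ∞) (α : {j : ℕ // (j : ℕ∞) < ω} → ℝ) (P : ℂ → ℂ),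
    0 ≤ γ ∧ (∀ j, α j ≠ 0) ∧ Summable (fun j => ((α j) ^ 2)⁻¹) ∧
    (∀ z : ℂ, HasProd (fun j => (1 - z / (α j : ℂ)) * Complex.exp (z / (α j : ℂ))) (P z)) ∧
    ∀ z : ℂ, f z = (c : ℂ) * z ^ d * Complex.exp (-(γ : ℂ) * z ^ 2 + (β : ℂ) * z) * P z}

/-- The class `L-P*`: products `p * f` of a real polynomial `p` without real zeros and a
function `f` of the Laguerre-Polya class. -/
def LaguerrePolyaStar : Set (ℂ → ℂ) :=
  {φ | ∃ (p : ℝ[X]) (f : ℂ → ℂ), (∀ x : ℝ, p.eval x ≠ 0) ∧ f ∈ LaguerrePolya ∧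
    ∀ z : ℂ, φ z = aeval z p * f z}

/-- `φ` has the form `C * exp (β z)` with real `C` and `β`. -/
def IsPureExponential (φ : ℂ → ℂ) : Prop :=
  ∃ C β : ℝ, ∀ z : ℂ, φ z = (C : ℂ) * Complex.exp ((β : ℂ) * z)

/-- The multiplicity of `z` as a zero of a meromorphic function `f`: it is `0` at poles and
wherever `f` does not vanish, and `⊤` if `f` vanishes identically around `z`.  It does not
depend on the value that the Lean function takes at `z` itself. -/
def zeroMultiplicity (f : ℂ → ℂ) (z : ℂ) : ℕ∞ :=
  WithTop.map Int.toNat (meromorphicOrderAt f z)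

/-- The number of zeros of `f` in `X`, counted with multiplicities (`⊤` if it is infinite). -/
def zeroCount (X : Set ℂ) (f : ℂ → ℂ) : ℕ∞ :=
  ⨆ s : {s : Finset ℂ // (s : Set ℂ) ⊆ X}, ∑ z ∈ s.1, zeroMultiplicity f z

/-- The number of nonreal zeros, counted with multiplicities. -/
def nonrealZeroCount (f : ℂ → ℂ) : ℕ∞ := zeroCount {z | z.im ≠ 0} f

/-- The number of real zeros, counted with multiplicities. -/
def realZeroCount (f : ℂ → ℂ) : ℕ∞ := zeroCount {z | z.im = 0} f

/-- `Q[φ] = (φ' / φ)'`. -/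
def logDerivDeriv (φ : ℂ → ℂ) : ℂ → ℂ := deriv (fun z => deriv φ z / φ z)

/-- `Q[φ]` has no zeros in the real interval `(a, b)`, where `a` and `b` may be infinite. -/
def NoZerosBetween (φ : ℂ → ℂ) (a b : EReal) : Prop :=
  ∀ x : ℝ, a < (x : EReal) → (x : EReal) < b → zeroMultiplicity (logDerivDeriv φ) (x : ℂ) = 0

/-- Property A at a real zero `α` of `φ`.  Here `β₁` is the zero of `φ'` that is closest to `α`
on the left, and `-∞` if there is none (which can happen only at the smallest real zero of `φ`);
`β₂` is its counterpart on the right. -/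
def HasPropertyAAt (φ : ℂ → ℂ) (α : ℝ) : Prop :=
  ∀ β₁ β₂ : EReal, β₁ < (α : EReal) → (α : EReal) < β₂ →
    (β₁ = ⊥ ∨ ∃ b : ℝ, β₁ = (b : EReal) ∧ deriv φ (b : ℂ) = 0) →
    (β₂ = ⊤ ∨ ∃ b : ℝ, β₂ = (b : EReal) ∧ deriv φ (b : ℂ) = 0) →
    (∀ x : ℝ, β₁ < (x : EReal) → (x : EReal) < β₂ → x ≠ α → deriv φ (x : ℂ) ≠ 0) →
    NoZerosBetween φ β₁ (α : EReal) ∨ NoZerosBetween φ (α : EReal) β₂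

/-- Property A: property A at every real zero. -/
def HasPropertyA (φ : ℂ → ℂ) : Prop :=
  ∀ α : ℝ, φ (α : ℂ) = 0 → HasPropertyAAt φ α

end

/-! Write L = φ'/φ, so that Q = L', and put D = L'/L = Q/L. Here [·] is 1 if the enclosed inequality
holds and 0 otherwise.

Control at infinity. The partial products of φ are real polynomials times exp(-γz² + bz). Pairing
conjugate roots gives Im L ≤ 0 in the upper half-plane outside a fixed disc, for these products and
for their derivatives, and the weak inequality survives the limit (`laguerrePolyaStar_properties`).
Outside a large disc φ and φ' therefore have no nonreal zeros. On the real axis beyond it Q < 0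
wherever φ ≠ 0, and Q₁ < 0 wherever φ' ≠ 0 unless φ' is a pure exponential
(`UpperNonpos.deriv_logDeriv_neg`). All counts become finite sums inside |z| < R.

Balance of zeros. L maps the open upper half of |z| = R into the lower half-plane, so the signs of
L(±R) alone determine its winding number. The argument principle gives #zeros(φ') - #zeros(φ) =
[L(-R) > 0] - [L(R) > 0] (`sum_orders_sub`). Splitting off the nonreal zeros turns this into a
statement about real zeros and 2m - 2m₁ (`exists_sum_orders_real`).

Lower bound. At each real point, ord φ' - ord φ - (zeros of Q) is at most the jump of [D > 0]
(`order_sub_le_jump`). The jumps telescope over [-R, R], and since Q(±R) < 0 the sign of D there is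
opposite to that of L, so the boundary terms cancel.

Upper bound. Since φ''/φ' = L + D, we have Q₁ = D' + LD, so a zero of D of order k is a zero of Q₁
of order k - 1. The jumps of [D Q₁ > 0] then bound (zeros of Q) - (zeros of Q₁) - (ord φ' - ord φ)
(`ratioMulQ_local`), except at simple zeros of φ with Q₁ > 0, where the bound fails by 2. Property A
supplies, next to each such point and before the next zero of φ', an odd zero of Q₁ where the bound
has slack 2 (`IsExceptional.exists_compensation`). By Rolle different exceptional points get
different compensators. -/

open Filter Topology ComplexConjugate

/-! ### Leading terms of meromorphic functions and signs near real points -/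

/-- `F` has the leading term `c * (z - x) ^ n` at `x`. -/
def LeadsAt (F : ℂ → ℂ) (x : ℂ) (n : ℤ) (c : ℂ) : Prop :=
  c ≠ 0 ∧ ∃ g : ℂ → ℂ, AnalyticAt ℂ g x ∧ g x = c ∧ F =ᶠ[𝓝[≠] x] fun z => (z - x) ^ n * g z

namespace LeadsAt

variable {F G : ℂ → ℂ} {x : ℂ} {n k : ℤ} {c d : ℂ}

theorem congr (h : LeadsAt F x n c) (hFG : G =ᶠ[𝓝[≠] x] F) : LeadsAt G x n c := by
  obtain ⟨hc, g, hg, hgx, hF⟩ := h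
  exact ⟨hc, g, hg, hgx, hFG.trans hF⟩

theorem meromorphicAt (h : LeadsAt F x n c) : MeromorphicAt F x := by
  obtain ⟨hc, g, hg, hgx, hF⟩ := h
  refine MeromorphicAt.congr ?_ hF.symm
  have := hg.meromorphicAt
  fun_prop

theorem order (h : LeadsAt F x n c) : meromorphicOrderAt F x = n := by
  rw [meromorphicOrderAt_eq_int_iff h.meromorphicAt]
  obtain ⟨hc, g, hg, hgx, hF⟩ := h
  exact ⟨g, hg, hgx ▸ hc, hF⟩

theorem exists_of_order (hF : MeromorphicAt F x) (hn : meromorphicOrderAt F x = n) :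
    ∃ c, LeadsAt F x n c := by
  rw [meromorphicOrderAt_eq_int_iff hF] at hn
  obtain ⟨g, hg, hgx, h⟩ := hn
  exact ⟨g x, hgx, g, hg, rfl, h⟩

theorem of_analyticAt (hF : AnalyticAt ℂ F x) (h0 : F x ≠ 0) : LeadsAt F x 0 (F x) :=
  ⟨h0, F, hF, rfl, by simp⟩

theorem mul (hF : LeadsAt F x n c) (hG : LeadsAt G x k d) :
    LeadsAt (fun z => F z * G z) x (n + k) (c * d) := by
  obtain ⟨hc, g, hg, hgx, hF⟩ := hF
  obtain ⟨hd, g', hg', hgx', hG⟩ := hG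
  refine ⟨mul_ne_zero hc hd, fun z => g z * g' z, hg.mul hg', by simp [hgx, hgx'], ?_⟩
  filter_upwards [hF, hG, self_mem_nhdsWithin] with z h1 h2 h3
  rw [h1, h2, zpow_add₀ (sub_ne_zero.2 h3)]
  ring

theorem div (hF : LeadsAt F x n c) (hG : LeadsAt G x k d) :
    LeadsAt (fun z => F z / G z) x (n - k) (c / d) := by
  obtain ⟨hc, g, hg, hgx, hF⟩ := hF
  obtain ⟨hd, g', hg', hgx', hG⟩ := hG
  refine ⟨div_ne_zero hc hd, fun z => g z / g' z, hg.div hg' (hgx' ▸ hd), by simp [hgx, hgx'], ?_⟩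
  filter_upwards [hF, hG, self_mem_nhdsWithin] with z h1 h2 h3
  rw [h1, h2, zpow_sub₀ (sub_ne_zero.2 h3), mul_div_mul_comm]

/-- Differentiation of an expansion, without assumption on the leading coefficient. -/
theorem deriv_expansion {g : ℂ → ℂ} (hg : AnalyticAt ℂ g x)
    (hF : F =ᶠ[𝓝[≠] x] fun z => (z - x) ^ n * g z) :
    deriv F =ᶠ[𝓝[≠] x] fun z => (z - x) ^ (n - 1) * (n * g z + (z - x) * deriv g z) := by
  filter_upwards [hF.nhdsNE_deriv, self_mem_nhdsWithin,
    hg.eventually_analyticAt.filter_mono nhdsWithin_le_nhds] with z h1 h2 h3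
  have h2' : z - x ≠ 0 := sub_ne_zero.2 h2
  have h4 : HasDerivAt (fun z => (z - x) ^ n) (n * (z - x) ^ (n - 1) * 1) z :=
    HasDerivAt.comp z (h₂ := fun w => w ^ n) (h := fun z => z - x)
      (hasDerivAt_zpow n (z - x) (Or.inl h2')) ((hasDerivAt_id' z).sub_const x)
  rw [h1, (h4.fun_mul h3.differentiableAt.hasDerivAt).deriv, zpow_sub_one₀ h2']
  field_simp

theorem deriv (hF : LeadsAt F x n c) (hn : n ≠ 0) : LeadsAt (deriv F) x (n - 1) (n * c) := by
  obtain ⟨hc, g, hg, hgx, hF⟩ := hF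
  refine ⟨mul_ne_zero (by exact_mod_cast hn) hc, fun z => n * g z + (z - x) * _root_.deriv g z, ?_,
    by simp [hgx], deriv_expansion hg hF⟩
  have := hg.deriv
  fun_prop

/-- Adding a term of higher order does not change the leading term. -/
theorem add_higher (hF : LeadsAt F x n c) {h : ℂ → ℂ} (hh : AnalyticAt ℂ h x)
    (hG : G =ᶠ[𝓝[≠] x] fun z => (z - x) ^ (n + 1) * h z) :
    LeadsAt (fun z => F z + G z) x n c := by
  obtain ⟨hc, g, hg, hgx, hF⟩ := hF
  refine ⟨hc, fun z => g z + (z - x) * h z, by fun_prop, by simp [hgx], ?_⟩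
  filter_upwards [hF, hG, self_mem_nhdsWithin] with z h1 h2 h3
  rw [h1, h2, zpow_add_one₀ (sub_ne_zero.2 h3)]
  ring

theorem eventually_ne_zero (hF : LeadsAt F x n c) : ∀ᶠ z in 𝓝[≠] x, F z ≠ 0 := by
  obtain ⟨hc, g, hg, hgx, hF⟩ := hF
  have : ∀ᶠ z in 𝓝[≠] x, g z ≠ 0 :=
    (hg.continuousAt.eventually_ne (hgx ▸ hc)).filter_mono nhdsWithin_le_nhds
  filter_upwards [hF, this, self_mem_nhdsWithin] with z h1 h2 h3
  rw [h1]
  exact mul_ne_zero (zpow_ne_zero _ (sub_ne_zero.2 h3)) h2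

end LeadsAt

theorem tendsto_ofReal_nhdsNE (x : ℝ) : Tendsto (fun y : ℝ => (y : ℂ)) (𝓝[≠] x) (𝓝[≠] (x : ℂ)) :=
  tendsto_nhdsWithin_of_tendsto_nhds_of_eventually_within _
    (Complex.continuous_ofReal.continuousAt.tendsto.mono_left nhdsWithin_le_nhds)
    (by filter_upwards [self_mem_nhdsWithin] with y hy; simpa using hy)

/-- The leading coefficient at a real point of a function that is real on the real axis is real. -/
theorem LeadsAt.coeff_real {F : ℂ → ℂ} {x : ℝ} {n : ℤ} {c : ℂ} (h : LeadsAt F x n c)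
    (hF : ∀ᶠ y : ℝ in 𝓝[≠] x, (F y).im = 0) : ∃ c' : ℝ, c = c' := by
  obtain ⟨hc, g, hg, hgx, hFg⟩ := h
  have h1 : Tendsto (fun y : ℝ => (g y).im) (𝓝[≠] x) (𝓝 c.im) := by
    rw [← hgx]
    exact (Complex.continuous_im.tendsto _).comp ((hg.continuousAt.tendsto.mono_left
      nhdsWithin_le_nhds).comp (tendsto_ofReal_nhdsNE x))
  have h2 : (fun y : ℝ => (g y).im) =ᶠ[𝓝[≠] x] fun _ => 0 := by
    filter_upwards [hF, (tendsto_ofReal_nhdsNE x).eventually hFg, self_mem_nhdsWithin]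
      with y h3 h4 h5
    have h6 : (y - x : ℝ) ^ n ≠ 0 := zpow_ne_zero _ (sub_ne_zero.2 h5)
    rw [h4, ← Complex.ofReal_sub, ← Complex.ofReal_zpow, Complex.im_ofReal_mul] at h3
    simpa [h6] using h3
  have h3 : c.im = 0 := tendsto_nhds_unique h1 (h2.tendsto)
  exact ⟨c.re, Complex.ext rfl (by simpa using h3)⟩

theorem LeadsAt.re_expansion {F : ℂ → ℂ} {x : ℝ} {n : ℤ} {c : ℝ} (h : LeadsAt F x n c) :
    ∀ᶠ y : ℝ in 𝓝[≠] x, 0 < c * (y - x) ^ n * (F y).re := by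
  obtain ⟨hc, g, hg, hgx, hFg⟩ := h
  have hc' : c ≠ 0 := by exact_mod_cast hc
  have h1 : Tendsto (fun y : ℝ => c * (g y).re) (𝓝[≠] x) (𝓝 (c * (c : ℂ).re)) := by
    rw [← hgx]
    exact ((Complex.continuous_re.tendsto _).comp ((hg.continuousAt.tendsto.mono_left
      nhdsWithin_le_nhds).comp (tendsto_ofReal_nhdsNE x))).const_mul c
  have h2 : 0 < c * (c : ℂ).re := by
    rw [Complex.ofReal_re]; exact mul_self_pos.2 hc'
  filter_upwards [h1.eventually_const_lt h2, (tendsto_ofReal_nhdsNE x).eventually hFg,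
    self_mem_nhdsWithin] with y h3 h4 h5
  have h6 : (y - x : ℝ) ^ n ≠ 0 := zpow_ne_zero _ (sub_ne_zero.2 h5)
  rw [h4, ← Complex.ofReal_sub, ← Complex.ofReal_zpow, Complex.re_ofReal_mul]
  have : 0 < (c * (g y).re) * ((y - x : ℝ) ^ n) ^ 2 := by positivity
  linarith [this, (by ring : (c * (g y).re) * ((y - x : ℝ) ^ n) ^ 2 =
    c * (y - x) ^ n * ((y - x) ^ n * (g y).re))]

/-- The sign to the right of a real point. -/
theorem LeadsAt.sign_right {F : ℂ → ℂ} {x : ℝ} {n : ℤ} {c : ℝ} (h : LeadsAt F x n c) :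
    ∀ᶠ y : ℝ in 𝓝[>] x, 0 < c * (F y).re := by
  filter_upwards [h.re_expansion.filter_mono (nhdsWithin_mono x fun y (hy : x < y) => hy.ne'),
    self_mem_nhdsWithin] with y h1 h2
  have h3 : 0 < (y - x : ℝ) ^ n := zpow_pos (sub_pos.2 h2) _
  rw [mul_right_comm] at h1
  exact pos_of_mul_pos_left h1 h3.le

/-- The sign to the left of a real point. -/
theorem LeadsAt.sign_left {F : ℂ → ℂ} {x : ℝ} {n : ℤ} {c : ℝ} (h : LeadsAt F x n c) :
    ∀ᶠ y : ℝ in 𝓝[<] x, 0 < (-1) ^ n * c * (F y).re := by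
  filter_upwards [h.re_expansion.filter_mono (nhdsWithin_mono x fun y (hy : y < x) => hy.ne),
    self_mem_nhdsWithin] with y h1 h2
  have h3 : 0 < (x - y : ℝ) ^ n := zpow_pos (sub_pos.2 h2) _
  have h4 : (y - x : ℝ) ^ n = (-1) ^ n * (x - y) ^ n := by rw [← mul_zpow]; ring_nf
  rw [h4] at h1
  refine pos_of_mul_pos_left (b := (x - y) ^ n) ?_ h3.le
  linarith [h1, (by ring : c * ((-1) ^ n * (x - y) ^ n) * (F y).re =
    (-1) ^ n * c * (F y).re * (x - y) ^ n)]

/-! ### Sign jumps and their telescoping -/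

/-- The indicator of positivity on the real axis. -/
noncomputable def posInd (F : ℂ → ℂ) (y : ℝ) : ℤ := if 0 < (F y).re then 1 else 0

/-- The jump of `posInd` at a point with leading term `c * (z - x) ^ n`. -/
noncomputable def signJump (n : ℤ) (c : ℝ) : ℤ := if Even n then 0 else if 0 < c then 1 else -1

/-- Just right of x the sign is that of c, just left of x it is that of (-1)^n c. Only odd orders
change the sign, and c gives the direction. -/
theorem LeadsAt.posInd_jump {F : ℂ → ℂ} {x : ℝ} {n : ℤ} {c : ℝ} (h : LeadsAt F x n c) :
    ∃ u v : ℤ, (∀ᶠ y in 𝓝[<] x, posInd F y = u) ∧ (∀ᶠ y in 𝓝[>] x, posInd F y = v) ∧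
      v - u = signJump n c := by
  have hc : c ≠ 0 := by exact_mod_cast h.1
  refine ⟨if 0 < (-1) ^ n * c then 1 else 0, if 0 < c then 1 else 0, ?_, ?_, ?_⟩
  · filter_upwards [h.sign_left] with y hy
    unfold posInd
    congr 1
    rw [pos_iff_pos_of_mul_pos hy]
  · filter_upwards [h.sign_right] with y hy
    unfold posInd
    congr 1
    rw [pos_iff_pos_of_mul_pos hy]
  · unfold signJump
    by_cases hn : Even n
    · simp [hn, hn.neg_one_zpow]
    · rw [Int.not_even_iff_odd] at hn
      rcases lt_or_gt_of_ne hc with h1 | h1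
      · simp [hn.neg_one_zpow, h1, h1.not_gt, Int.not_even_iff_odd.2 hn]
      · simp [hn.neg_one_zpow, h1, h1.not_gt, Int.not_even_iff_odd.2 hn]

theorem eq_of_locally_constant_on_Icc (U : ℝ → ℤ) {a b : ℝ} (hab : a ≤ b)
    (h : ∀ x ∈ Set.Icc a b, ∀ᶠ y in 𝓝 x, U y = U x) : U a = U b := by
  have h1 : ContinuousOn U (Set.Icc a b) := fun x hx =>
    ((continuousAt_const.congr (f := fun _ => U x)
      ((h x hx).mono fun y hy => hy.symm))).continuousWithinAt
  exact isPreconnected_Icc.constant h1 (Set.left_mem_Icc.2 hab) (Set.right_mem_Icc.2 hab)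

theorem eventually_notMem_finset (S : Finset ℝ) (x : ℝ) : ∀ᶠ y in 𝓝[≠] x, y ∉ S := by
  have : ((S : Set ℝ) \ {x})ᶜ ∈ 𝓝 x :=
    (S.finite_toSet.subset Set.sdiff_subset).isClosed.isOpen_compl.mem_nhds (by simp)
  filter_upwards [mem_nhdsWithin_of_mem_nhds this, self_mem_nhdsWithin] with y h1 h2 h3
  exact h1 ⟨h3, h2⟩

/-- Telescoping of the jumps of a step function. -/
theorem sum_jumps (U J : ℝ → ℤ) (S : Finset ℝ) {a b : ℝ} (hab : a ≤ b)
    (hS : ∀ x ∈ S, x ∈ Set.Ioo a b)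
    (hloc : ∀ x ∈ Set.Icc a b, x ∉ S → ∀ᶠ y in 𝓝 x, U y = U x)
    (hjump : ∀ x ∈ S, ∃ u v : ℤ, (∀ᶠ y in 𝓝[<] x, U y = u) ∧ (∀ᶠ y in 𝓝[>] x, U y = v) ∧
      v - u = J x) :
    ∑ x ∈ S, J x = U b - U a := by
  choose! u v hu hv huv using hjump
  -- U with all jumps to the left of y removed. On S the value is replaced by the left limit, and
  -- the strict inequality x < y makes a jump count only after its point. Thus V is locally constant
  -- even across S.
  let V : ℝ → ℤ := fun y => (if y ∈ S then u y else U y) - ∑ x ∈ S with x < y, J x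
  have hfar := eventually_notMem_finset S
  have hsumL : ∀ x, ∀ᶠ y in 𝓝[≤] x, ∑ z ∈ S with z < y, J z = ∑ z ∈ S with z < x, J z := by
    intro x
    have : ∀ᶠ y in 𝓝 x, ∀ z ∈ S, z < x → z < y :=
      (Finset.eventually_all S).2 fun z _ => by
        by_cases h : z < x
        · filter_upwards [lt_mem_nhds h] with y hy _ using hy
        · exact Eventually.of_forall fun y h' => absurd h' h
    filter_upwards [nhdsWithin_le_nhds this, self_mem_nhdsWithin] with y h1 h2
    congr 1
    ext z
    simp only [Finset.mem_filter, and_congr_right_iff]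
    exact fun hz => ⟨fun h => lt_of_lt_of_le h h2, h1 z hz⟩
  have hsumR : ∀ x, ∀ᶠ y in 𝓝[>] x, ∑ z ∈ S with z < y, J z = ∑ z ∈ S with z ≤ x, J z := by
    intro x
    have : ∀ᶠ y in 𝓝 x, ∀ z ∈ S, x < z → y < z :=
      (Finset.eventually_all S).2 fun z _ => by
        by_cases h : x < z
        · filter_upwards [gt_mem_nhds h] with y hy _ using hy
        · exact Eventually.of_forall fun y h' => absurd h' h
    filter_upwards [nhdsWithin_le_nhds this, self_mem_nhdsWithin] with y h1 h2
    congr 1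
    ext z
    simp only [Finset.mem_filter, and_congr_right_iff]
    refine fun hz => ⟨fun h => ?_, fun h => lt_of_le_of_lt h h2⟩
    by_contra h'
    exact lt_asymm h (h1 z hz (not_le.1 h'))
  have hV : ∀ x ∈ Set.Icc a b, ∀ᶠ y in 𝓝 x, V y = V x := by
    intro x hx
    have hLeft : ∀ᶠ y in 𝓝[<] x, V y = V x := by
      have hU : ∀ᶠ y in 𝓝[<] x, U y = if x ∈ S then u x else U x := by
        by_cases hxS : x ∈ S
        · simpa [hxS] using hu x hxS
        · simpa [hxS] using (hloc x hx hxS).filter_mono nhdsWithin_le_nhds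
      filter_upwards [(hsumL x).filter_mono (nhdsWithin_mono x fun y (hy : y < x) => hy.le), hU,
        (hfar x).filter_mono (nhdsWithin_mono x fun y (hy : y < x) => hy.ne)] with y h1 h2 h3
      simp only [V, h1, h3, h2, if_false]
    have hRight : ∀ᶠ y in 𝓝[>] x, V y = V x := by
      have hU : ∀ᶠ y in 𝓝[>] x, U y = if x ∈ S then v x else U x := by
        by_cases hxS : x ∈ S
        · simpa [hxS] using hv x hxS
        · simpa [hxS] using (hloc x hx hxS).filter_mono nhdsWithin_le_nhds
      filter_upwards [hsumR x, hU,
        (hfar x).filter_mono (nhdsWithin_mono x fun y (hy : x < y) => hy.ne')] with y h1 h2 h3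
      have h4 : ∑ z ∈ S with z ≤ x, J z =
          (∑ z ∈ S with z < x, J z) + if x ∈ S then J x else 0 := by
        simp only [Finset.sum_filter]
        rw [← Finset.sum_ite_eq' S x J, ← Finset.sum_add_distrib]
        refine Finset.sum_congr rfl fun z _ => ?_
        rcases lt_trichotomy z x with h | h | h
        · simp [h, h.le, h.ne]
        · simp [h]
        · simp [h.not_gt, h.not_ge, h.ne']
      simp only [V, h1, h3, h2, if_false, h4]
      by_cases hxS : x ∈ S
      · simp only [hxS, if_true, ← huv x hxS]
        ring
      · simp [hxS]
    have hNE : ∀ᶠ y in 𝓝[≠] x, V y = V x := by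
      rw [← Set.Iio_union_Ioi, nhdsWithin_union, eventually_sup]
      exact ⟨hLeft, hRight⟩
    filter_upwards [eventually_nhdsWithin_iff.1 hNE] with y hy
    by_cases h : y = x
    · rw [h]
    · exact hy h
  have h := eq_of_locally_constant_on_Icc V hab hV
  have ha : a ∉ S := fun h => lt_irrefl _ (hS a h).1
  have hb : b ∉ S := fun h => lt_irrefl _ (hS b h).2
  have h1 : S.filter (fun z => z < a) = ∅ :=
    Finset.filter_eq_empty_iff.2 fun z hz => (hS z hz).1.not_gt
  have h2 : S.filter (fun z => z < b) = S :=
    Finset.filter_eq_self.2 fun z hz => (hS z hz).2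
  simp only [V, ha, hb, if_false, h1, h2, Finset.sum_empty] at h
  linarith

/-! ### Logarithmic derivatives with nonpositive imaginary part -/

/-- `f` takes conjugate values at conjugate points. -/
def ConjSymm (f : ℂ → ℂ) : Prop := ∀ z, f (conj z) = conj (f z)

theorem ConjSymm.deriv {f : ℂ → ℂ} (hf : ConjSymm f) : ConjSymm (deriv f) := by
  intro z
  have h : (conj ∘ f ∘ conj) = f := by
    funext w
    simp [hf w]
  have h1 := congrFun (deriv_conj_conj (𝕜 := ℂ) (f := f)) (conj z)
  rw [h] at h1
  simpa using h1

theorem ConjSymm.im_eq_zero {f : ℂ → ℂ} (hf : ConjSymm f) (x : ℝ) : (f x).im = 0 := by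
  have := hf x
  rw [Complex.conj_ofReal] at this
  exact Complex.conj_eq_iff_im.1 this.symm

theorem ConjSymm.div {f g : ℂ → ℂ} (hf : ConjSymm f) (hg : ConjSymm g) :
    ConjSymm (fun z => f z / g z) := fun z => by simp [hf z, hg z]

/-- The logarithmic derivative of `f` maps the part `‖z‖ > r` of the upper half-plane into the
closed lower half-plane. -/
def UpperNonpos (r : ℝ) (f : ℂ → ℂ) : Prop :=
  ∀ z : ℂ, 0 < z.im → r < ‖z‖ → (deriv f z / f z).im ≤ 0

/-- Along the ray x + εu the leading term is ε^n u^n c. This is the source of contradictions to Im L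
≤ 0: a suitable direction u makes the imaginary part positive. -/
theorem LeadsAt.im_pos_ray {F : ℂ → ℂ} {x : ℂ} {n : ℤ} {c u : ℂ} (h : LeadsAt F x n c)
    (hu : 0 < (u ^ n * c).im) (hu0 : u ≠ 0) :
    ∀ᶠ ε : ℝ in 𝓝[>] 0, 0 < (F (x + ε * u)).im := by
  obtain ⟨hc, g, hg, hgx, hFg⟩ := h
  have ht : Tendsto (fun ε : ℝ => x + ε * u) (𝓝[>] 0) (𝓝[≠] x) := by
    refine tendsto_nhdsWithin_of_tendsto_nhds_of_eventually_within _ ?_ ?_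
    · refine Tendsto.mono_left ?_ nhdsWithin_le_nhds
      have : Continuous fun ε : ℝ => x + ε * u := by fun_prop
      simpa using this.tendsto 0
    · filter_upwards [self_mem_nhdsWithin] with ε hε
      have : (ε : ℂ) ≠ 0 := by exact_mod_cast (ne_of_gt hε)
      simp [this, hu0]
  have h1 : Tendsto (fun ε : ℝ => (u ^ n * g (x + ε * u)).im) (𝓝[>] 0) (𝓝 (u ^ n * c).im) := by
    refine (Complex.continuous_im.tendsto _).comp (Tendsto.const_mul _ ?_)
    rw [← hgx]
    exact (hg.continuousAt.tendsto.mono_left nhdsWithin_le_nhds).comp ht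
  filter_upwards [h1.eventually_const_lt hu, ht.eventually hFg, self_mem_nhdsWithin]
    with ε h2 h3 h4
  rw [h3, add_sub_cancel_left, mul_zpow, mul_assoc, ← Complex.ofReal_zpow, Complex.im_ofReal_mul]
  exact mul_pos (zpow_pos h4 _) h2

theorem eventually_ray_mem {x u : ℂ} {s : Set ℂ} (hs : s ∈ 𝓝 x) :
    ∀ᶠ ε : ℝ in 𝓝[>] 0, x + ε * u ∈ s := by
  have : Continuous fun ε : ℝ => x + ε * u := by fun_prop
  have := this.tendsto 0
  simp only [Complex.ofReal_zero, zero_mul, add_zero] at this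
  exact nhdsWithin_le_nhds (this hs)

theorem order_natCast_of_ne_zero {f : ℂ → ℂ} (hf : Differentiable ℂ f) (h0 : f ≠ 0) (z : ℂ) :
    ∃ (n : ℕ) (c : ℂ), LeadsAt f z n c ∧ (n = 0 ↔ f z ≠ 0) := by
  have ha := hf.analyticAt z
  have htop : analyticOrderAt f z ≠ ⊤ := by
    intro h
    rw [analyticOrderAt_eq_top] at h
    refine h0 (AnalyticOnNhd.eq_of_eventuallyEq (f := f) (g := 0) (z₀ := z)
      (fun w _ => hf.analyticAt w) (fun w _ => analyticAt_const) h)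
  obtain ⟨n, hn⟩ := ENat.ne_top_iff_exists.1 htop
  have h2 : meromorphicOrderAt f z = ((n : ℤ) : WithTop ℤ) := by
    rw [ha.meromorphicOrderAt_eq, ← hn]; rfl
  obtain ⟨c, hc⟩ := LeadsAt.exists_of_order ha.meromorphicAt h2
  refine ⟨n, c, hc, ?_⟩
  rw [← ha.analyticOrderAt_eq_zero, ← hn]
  simp

theorem LeadsAt.logDeriv {f : ℂ → ℂ} {z c : ℂ} {n : ℤ} (h : LeadsAt f z n c) (hn : n ≠ 0) :
    LeadsAt (fun w => _root_.deriv f w / f w) z (-1) n := by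
  have := (h.deriv hn).div h
  rwa [mul_div_assoc, div_self h.1, mul_one, sub_sub_cancel_left] at this

/-- A constant logarithmic derivative means an exponential. -/
theorem isPureExponential_of_eventually {f : ℂ → ℂ} (hf : Differentiable ℂ f) (hs : ConjSymm f)
    {z : ℂ} {k : ℝ} (h : ∀ᶠ w in 𝓝 z, deriv f w = k * f w) : IsPureExponential f := by
  have hd : Differentiable ℂ (deriv f) := fun w => (hf.analyticAt w).deriv.differentiableAt
  have h1 : deriv f = fun w => k * f w :=
    AnalyticOnNhd.eq_of_eventuallyEq (z₀ := z) (fun w _ => hd.analyticAt w)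
      (fun w _ => (hf.const_mul (k : ℂ)).analyticAt w) h
  have h2 : ∀ w, HasDerivAt (fun w => f w * Complex.exp (-(k * w))) 0 w := by
    intro w
    have h3 : HasDerivAt (fun w : ℂ => Complex.exp (-(k * w))) (Complex.exp (-(k * w)) * -(k * 1)) w :=
      (((hasDerivAt_id' w).const_mul (k : ℂ)).neg).cexp
    have h4 := (hf w).hasDerivAt.fun_mul h3
    have h5 : deriv f w * Complex.exp (-(k * w)) + f w * (Complex.exp (-(k * w)) * -(k * 1)) = 0 := by
      rw [h1]
      ring
    rwa [h5] at h4
  have h4 : ∀ w, f w * Complex.exp (-(k * w)) = f 0 := by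
    intro w
    have := is_const_of_deriv_eq_zero (fun w => (h2 w).differentiableAt) (fun w => (h2 w).deriv) w 0
    simpa using this
  refine ⟨(f 0).re, k, fun w => ?_⟩
  have h5 : ((f 0).re : ℂ) = f 0 :=
    Complex.ext (by simp) (by simpa using (hs.im_eq_zero 0).symm)
  rw [h5, ← h4 w, mul_assoc, ← Complex.exp_add]
  simp

theorem deriv_entire {f : ℂ → ℂ} (hf : Differentiable ℂ f) : Differentiable ℂ (deriv f) :=
  fun w => (hf.analyticAt w).deriv.differentiableAt

theorem logDeriv_analyticAt {f : ℂ → ℂ} (hf : Differentiable ℂ f) {z : ℂ} (hz : f z ≠ 0) :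
    AnalyticAt ℂ (fun w => deriv f w / f w) z :=
  (hf.analyticAt z).deriv.div (hf.analyticAt z) hz

/-- The leading term of `L - L(z)` for the logarithmic derivative `L`. -/
theorem logDeriv_sub_leadsAt {f : ℂ → ℂ} (hf : Differentiable ℂ f) (hs : ConjSymm f)
    (hexp : ¬ IsPureExponential f) {z : ℂ} (hz : f z ≠ 0) (him : (deriv f z / f z).im = 0) :
    ∃ (n : ℕ) (c : ℂ), n ≠ 0 ∧ LeadsAt (fun w => deriv f w / f w - deriv f z / f z) z n c := by
  have ha : AnalyticAt ℂ (fun w => deriv f w / f w - deriv f z / f z) z :=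
    (logDeriv_analyticAt hf hz).sub analyticAt_const
  have htop : analyticOrderAt (fun w => deriv f w / f w - deriv f z / f z) z ≠ ⊤ := by
    intro h
    rw [analyticOrderAt_eq_top] at h
    refine hexp (isPureExponential_of_eventually hf hs (z := z) (k := (deriv f z / f z).re) ?_)
    have hk : (((deriv f z / f z).re : ℝ) : ℂ) = deriv f z / f z := Complex.ext (by simp) (by simp [him])
    filter_upwards [h, hf.continuous.continuousAt.eventually_ne hz] with w h1 h2
    rw [hk, ← sub_eq_zero.1 h1, div_mul_cancel₀ _ h2]
  obtain ⟨n, hn⟩ := ENat.ne_top_iff_exists.1 htop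
  have h2 : meromorphicOrderAt (fun w => deriv f w / f w - deriv f z / f z) z
      = ((n : ℤ) : WithTop ℤ) := by
    rw [ha.meromorphicOrderAt_eq, ← hn]; rfl
  obtain ⟨c, hc⟩ := LeadsAt.exists_of_order ha.meromorphicAt h2
  refine ⟨n, c, ?_, hc⟩
  rintro rfl
  have := ha.analyticOrderAt_eq_zero.1 hn.symm
  simp at this

namespace UpperNonpos

variable {r : ℝ} {f : ℂ → ℂ}

theorem ne_zero_of_im_pos (h : UpperNonpos r f) (hf : Differentiable ℂ f) (h0 : f ≠ 0) {z : ℂ}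
    (hz : 0 < z.im) (hr : r < ‖z‖) : f z ≠ 0 := by
  intro hfz
  obtain ⟨n, c, hc, hn⟩ := order_natCast_of_ne_zero hf h0 z
  have hn0 : n ≠ 0 := fun h => hn.1 h hfz
  have h1 := hc.logDeriv (by exact_mod_cast hn0)
  -- Below a zero of multiplicity n, L behaves like n/(-iε) = in/ε.
  have h2 := h1.im_pos_ray (u := -Complex.I) (by
    have : 0 < n := Nat.pos_of_ne_zero hn0
    simpa using this) (by simp)
  have h3 : ∀ᶠ ε : ℝ in 𝓝[>] 0, z + ε * (-Complex.I) ∈ {w : ℂ | 0 < w.im ∧ r < ‖w‖} :=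
    eventually_ray_mem (((isOpen_lt continuous_const Complex.continuous_im).inter
      (isOpen_lt continuous_const continuous_norm)).mem_nhds ⟨hz, hr⟩)
  obtain ⟨ε, h4, h5, h6⟩ := (h2.and h3).exists
  exact absurd (h _ h5 h6) (not_le.2 h4)

/-- An open mapping argument: if L were real at z, then L - L(z) would have a leading term c(w -
z)^n with n ≥ 1, and the direction u with u^n c = i would lead into Im L > 0. -/
theorem im_neg (h : UpperNonpos r f) (hf : Differentiable ℂ f) (hs : ConjSymm f)
    (hexp : ¬ IsPureExponential f) {z : ℂ} (hz : 0 < z.im) (hr : r < ‖z‖) (hfz : f z ≠ 0) :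
    (deriv f z / f z).im < 0 := by
  refine lt_of_le_of_ne (h z hz hr) fun him => ?_
  obtain ⟨n, c, hn, hc⟩ := logDeriv_sub_leadsAt hf hs hexp hfz him
  obtain ⟨u, hu⟩ := IsAlgClosed.exists_pow_nat_eq (Complex.I / c) (Nat.pos_of_ne_zero hn)
  have hu' : u ^ (n : ℤ) * c = Complex.I := by
    rw [zpow_natCast, hu, div_mul_cancel₀ _ hc.1]
  have hu0 : u ≠ 0 := by
    rintro rfl
    simp [zero_zpow (n : ℤ) (by exact_mod_cast hn)] at hu'
    exact Complex.I_ne_zero hu'.symm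
  have h2 := hc.im_pos_ray (u := u) (by rw [hu']; simp) hu0
  have h3 : ∀ᶠ ε : ℝ in 𝓝[>] 0, z + ε * u ∈ {w : ℂ | 0 < w.im ∧ r < ‖w‖} :=
    eventually_ray_mem (((isOpen_lt continuous_const Complex.continuous_im).inter
      (isOpen_lt continuous_const continuous_norm)).mem_nhds ⟨hz, hr⟩)
  obtain ⟨ε, h4, h5, h6⟩ := (h2.and h3).exists
  rw [Complex.sub_im, him, sub_zero] at h4
  exact absurd (h _ h5 h6) (not_le.2 h4)

/-- On the real axis the logarithmic derivative decreases outside the disc. -/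
theorem deriv_logDeriv_neg (h : UpperNonpos r f) (hf : Differentiable ℂ f) (hs : ConjSymm f)
    (hexp : ¬ IsPureExponential f) {x : ℝ} (hr : r < ‖(x : ℂ)‖) (hfx : f x ≠ 0) :
    (logDerivDeriv f x).re < 0 := by
  have him : (deriv f x / f x).im = 0 := (hs.deriv.div hs).im_eq_zero x
  obtain ⟨n, c, hn, hc⟩ := logDeriv_sub_leadsAt hf hs hexp hfx him
  obtain ⟨c, rfl⟩ := hc.coeff_real (Eventually.of_forall fun y => by
    rw [Complex.sub_im, him, (hs.deriv.div hs).im_eq_zero y, sub_zero])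
  have key : ∀ u : ℂ, 0 < u.im → ¬ 0 < (u ^ (n : ℤ) * c).im := by
    intro u hu hpos
    have h2 := hc.im_pos_ray hpos (by rintro rfl; simp at hu)
    have h3 : ∀ᶠ ε : ℝ in 𝓝[>] 0, (x : ℂ) + ε * u ∈ {w : ℂ | r < ‖w‖} :=
      eventually_ray_mem ((isOpen_lt continuous_const continuous_norm).mem_nhds hr)
    obtain ⟨ε, ⟨h4, h6⟩, h5⟩ := ((h2.and h3).and (self_mem_nhdsWithin (a := (0:ℝ)))).exists
    rw [Complex.sub_im, him, sub_zero] at h4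
    refine absurd (h _ ?_ h6) (not_le.2 h4)
    simpa using mul_pos h5 hu
  have hc0 : c ≠ 0 := by exact_mod_cast hc.1
  -- At a real point only the directions exp(iθ) with 0 < θ < π are available, and c is real. The
  -- condition is that sin(nθ)c is never positive there.
  have hrot : ∀ θ : ℝ, 0 < θ → θ < Real.pi → ¬ 0 < Real.sin (n * θ) * c := by
    intro θ h1 h2 h3
    refine key (Complex.exp (θ * Complex.I)) ?_ ?_
    · rw [Complex.exp_ofReal_mul_I_im]
      exact Real.sin_pos_of_pos_of_lt_pi h1 h2
    · rw [zpow_natCast, ← Complex.exp_nat_mul, Complex.im_mul_ofReal, ← mul_assoc]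
      have : (n : ℂ) * θ = ((n * θ : ℝ) : ℂ) := by push_cast; ring
      rwa [this, Complex.exp_ofReal_mul_I_im]
  have hpi := Real.pi_pos
  have hn' : (0 : ℝ) < n := by exact_mod_cast Nat.pos_of_ne_zero hn
  have hcneg : c < 0 := by
    rcases lt_or_gt_of_ne hc0 with h1 | h1
    · exact h1
    -- The angle nθ = π/2 excludes c > 0.
    · refine absurd ?_ (hrot (Real.pi / 2 / n) (by positivity) ?_)
      · rw [mul_div_cancel₀ _ hn'.ne', Real.sin_pi_div_two]; linarith
      · rw [div_lt_iff₀ hn']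
        have : (1 : ℝ) ≤ n := by exact_mod_cast Nat.one_le_iff_ne_zero.2 hn
        nlinarith
  have hn1 : n = 1 := by
    by_contra hne
    have h2 : (2 : ℝ) ≤ n := by exact_mod_cast (by omega : 2 ≤ n)
    -- For n ≥ 2 the angle nθ = 3π/2 is also reached with θ < π, where the sine is -1 and c < 0
    -- gives a positive product.
    refine absurd ?_ (hrot (3 * Real.pi / 2 / n) (by positivity) ?_)
    · rw [mul_div_cancel₀ _ hn'.ne',
        (by ring : 3 * Real.pi / 2 = Real.pi / 2 + Real.pi), Real.sin_add_pi, Real.sin_pi_div_two]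
      linarith
    · rw [div_lt_iff₀ hn']
      nlinarith
  subst hn1
  obtain ⟨-, g, hg, hgx, hFg⟩ := hc
  have hFg' : (fun w => deriv f w / f w) =ᶠ[𝓝 (x : ℂ)]
      fun w => deriv f x / f x + (w - x) * g w := by
    filter_upwards [eventually_nhdsWithin_iff.1 hFg] with w hw
    by_cases hwx : w = x
    · simp [hwx]
    · have := hw hwx
      simp only [Nat.cast_one, zpow_one] at this
      rw [← this]; ring
  have hder : HasDerivAt (fun w : ℂ => deriv f x / f x + (w - x) * g w)
      (1 * g x + (x - x) * deriv g x) x :=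
    (((hasDerivAt_id' (x : ℂ)).sub_const (x : ℂ)).mul
      hg.differentiableAt.hasDerivAt).const_add _
  have : logDerivDeriv f x = c := by
    unfold logDerivDeriv
    rw [hFg'.deriv_eq, hder.deriv, hgx]
    simp
  rw [this]
  simpa using hcneg

end UpperNonpos

/-! ### Polynomials times Gaussians -/

/-- This is the computation behind Jensen's circles: the sum of the two imaginary parts has the sign
of -Im z exactly when z lies outside the disc with diameter from a to its conjugate. The radius 2ρ
keeps z outside all these discs. -/
theorem im_inv_sub_add_im_inv_sub_conj {ρ : ℝ} {z a : ℂ} (hz : 0 < z.im) (hr : 2 * ρ < ‖z‖)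
    (ha : a.im = 0 ∨ ‖a‖ ≤ ρ) : (1 / (z - a)).im + (1 / (z - conj a)).im < 0 := by
  -- That z lies outside the Jensen disc of a.
  have hkey : a.im ^ 2 < (z.re - a.re) ^ 2 + z.im ^ 2 := by
    rcases ha with ha | ha
    · rw [ha, zero_pow two_ne_zero]; positivity
    · have h1 : ρ < ‖z - (a.re : ℂ)‖ := by
        have h2 := norm_sub_norm_le z (a.re : ℂ)
        have h3 := (Complex.abs_re_le_norm a).trans ha
        rw [Complex.norm_real, Real.norm_eq_abs] at h2
        linarith
      have h0 : 0 ≤ ρ := (norm_nonneg a).trans ha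
      have h4 : ‖z - (a.re : ℂ)‖ ^ 2 = (z.re - a.re) ^ 2 + z.im ^ 2 := by
        rw [← Complex.normSq_eq_norm_sq, Complex.normSq_apply]
        simp
        ring
      have h5 : a.im ^ 2 ≤ ρ ^ 2 := sq_le_sq.2 (by
        rw [abs_of_nonneg h0]; exact (Complex.abs_im_le_norm a).trans ha)
      rw [← h4]
      exact h5.trans_lt (by gcongr)
  have hd1 : 0 < (z.re - a.re) ^ 2 + (z.im - a.im) ^ 2 := by
    by_contra hle
    have h1 : (z.re - a.re) ^ 2 = 0 := by nlinarith [sq_nonneg (z.re - a.re), sq_nonneg (z.im - a.im)]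
    have h2 : (z.im - a.im) ^ 2 = 0 := by nlinarith [sq_nonneg (z.re - a.re), sq_nonneg (z.im - a.im)]
    rw [h1, sub_eq_zero.1 (pow_eq_zero_iff (two_ne_zero) |>.1 h2)] at hkey
    linarith
  have hd2 : 0 < (z.re - a.re) ^ 2 + (z.im + a.im) ^ 2 := by
    by_contra hle
    have h1 : (z.re - a.re) ^ 2 = 0 := by nlinarith [sq_nonneg (z.re - a.re), sq_nonneg (z.im + a.im)]
    have h2 : (z.im + a.im) ^ 2 = 0 := by nlinarith [sq_nonneg (z.re - a.re), sq_nonneg (z.im + a.im)]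
    have h3 : z.im = - a.im := by linarith [pow_eq_zero_iff (two_ne_zero) |>.1 h2]
    rw [h1, h3] at hkey
    nlinarith
  have e1 : (1 / (z - a)).im = -(z.im - a.im) / ((z.re - a.re) ^ 2 + (z.im - a.im) ^ 2) := by
    rw [one_div, Complex.inv_im, Complex.normSq_apply, Complex.sub_im, Complex.sub_re]
    ring_nf
  have e2 : (1 / (z - conj a)).im = -(z.im + a.im) / ((z.re - a.re) ^ 2 + (z.im + a.im) ^ 2) := by
    rw [one_div, Complex.inv_im, Complex.normSq_apply, Complex.sub_im, Complex.sub_re,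
      Complex.conj_re, Complex.conj_im]
    ring_nf
  rw [e1, e2, div_add_div _ _ hd1.ne' hd2.ne']
  refine div_neg_of_neg_of_pos ?_ (mul_pos hd1 hd2)
  have : 0 < 2 * z.im * ((z.re - a.re) ^ 2 + z.im ^ 2 - a.im ^ 2) :=
    mul_pos (by linarith) (by linarith)
  nlinarith

theorem aeval_conj_real (q : ℝ[X]) (z : ℂ) : aeval (conj z) q = conj (aeval z q) :=
  Polynomial.aeval_conj q z

/-- The nonreal zeros of the real polynomial `q` lie in the disc of radius `ρ`. -/
def NonrealRootsIn (ρ : ℝ) (q : ℝ[X]) : Prop := ∀ z : ℂ, aeval z q = 0 → z.im = 0 ∨ ‖z‖ ≤ ρ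

namespace NonrealRootsIn

variable {ρ : ℝ} {q : ℝ[X]} {z : ℂ}

theorem aeval_ne_zero (hq : NonrealRootsIn ρ q) (hρ : 0 ≤ ρ) (hz : 0 < z.im) (hr : 2 * ρ < ‖z‖) :
    aeval z q ≠ 0 := by
  intro h
  rcases hq z h with h1 | h1 <;> linarith

/-- Twice the imaginary part is a sum over the roots a of the contributions of a and its conjugate,
each negative. Hence equality forces the absence of roots; this rigidity is needed for the zeros of
the derivative. -/
theorem im_logDeriv (hq : NonrealRootsIn ρ q) (hρ : 0 ≤ ρ) (hz : 0 < z.im) (hr : 2 * ρ < ‖z‖) :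
    (aeval z (derivative q) / aeval z q).im ≤ 0 ∧
      ((aeval z (derivative q) / aeval z q).im = 0 → q.natDegree = 0) := by
  set Q := q.map (algebraMap ℝ ℂ) with hQ
  have hev : ∀ w : ℂ, Q.eval w = aeval w q := fun w => by rw [hQ, eval_map_algebraMap]
  have hev' : ∀ w : ℂ, Q.derivative.eval w = aeval w (derivative q) := fun w => by
    rw [hQ, derivative_map, eval_map_algebraMap]
  have h0 : aeval z q ≠ 0 := hq.aeval_ne_zero hρ hz hr
  have h0' : aeval (conj z) q ≠ 0 := by
    rw [aeval_conj_real]; simpa using h0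
  have hsp := IsAlgClosed.splits Q
  have hq0 : q ≠ 0 := by rintro rfl; simp at h0
  have hQ0 : Q ≠ 0 := (Polynomial.map_ne_zero_iff (algebraMap ℝ ℂ).injective).2 hq0
  have hs1 := hsp.eval_derivative_div_eval_of_ne_zero (x := z) (by rwa [hev])
  have hs2 := hsp.eval_derivative_div_eval_of_ne_zero (x := conj z) (by rwa [hev])
  rw [hev, hev'] at hs1 hs2
  rw [aeval_conj_real, aeval_conj_real, ← map_div₀] at hs2
  have hroots : ∀ a ∈ Q.roots, a.im = 0 ∨ ‖a‖ ≤ ρ := fun a ha => by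
    refine hq a ?_
    rw [← hev]
    exact (mem_roots hQ0).1 ha
  have him : ∀ (s : Multiset ℂ) (w : ℂ), ((s.map fun a => 1 / (w - a)).sum).im =
      (s.map fun a => (1 / (w - a)).im).sum := fun s w => by
    rw [← Complex.imCLM_apply, map_multiset_sum, Multiset.map_map]
    rfl
  have h1 : (aeval z (derivative q) / aeval z q).im = (Q.roots.map fun a => (1 / (z - a)).im).sum := by
    rw [hs1, him]
  -- The same sum with conjugated roots, obtained by evaluating at the conjugate of z. No symmetry
  -- of the multiset of roots is needed.
  have h2 : (aeval z (derivative q) / aeval z q).im =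
      (Q.roots.map fun a => (1 / (z - conj a)).im).sum := by
    have h3 : (aeval z (derivative q) / aeval z q).im =
        -(conj (aeval z (derivative q) / aeval z q)).im := by
      rw [Complex.conj_im, neg_neg]
    rw [h3, hs2, him, ← Multiset.sum_map_neg', Multiset.map_map]
    congr 1
    refine Multiset.map_congr rfl fun a _ => ?_
    have : 1 / (z - conj a) = conj (1 / (conj z - a)) := by simp
    rw [this, Complex.conj_im]
    rfl
  have h3 : 2 * (aeval z (derivative q) / aeval z q).im =
      (Q.roots.map fun a => (1 / (z - a)).im + (1 / (z - conj a)).im).sum := by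
    rw [Multiset.sum_map_add, ← h1, ← h2]; ring
  have hneg : ∀ s : Multiset ℂ, (∀ a ∈ s, a.im = 0 ∨ ‖a‖ ≤ ρ) →
      (s.map fun a => (1 / (z - a)).im + (1 / (z - conj a)).im).sum ≤ 0 ∧
      ((s.map fun a => (1 / (z - a)).im + (1 / (z - conj a)).im).sum = 0 → s = 0) := by
    intro s
    induction s using Multiset.induction_on with
    | empty => simp
    | cons a s ih =>
      intro hs
      have h4 := im_inv_sub_add_im_inv_sub_conj hz hr (hs a (Multiset.mem_cons_self a s))
      have h5 := ih fun b hb => hs b (Multiset.mem_cons_of_mem hb)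
      rw [Multiset.map_cons, Multiset.sum_cons]
      exact ⟨by linarith [h5.1], fun h => absurd h (by linarith [h5.1])⟩
  have h4 := hneg Q.roots hroots
  rw [← h3] at h4
  refine ⟨by linarith [h4.1], fun h => ?_⟩
  have h5 := h4.2 (by rw [h]; ring)
  rw [← natDegree_map (algebraMap ℝ ℂ), ← hQ, hsp.natDegree_eq_card_roots, h5]
  rfl

end NonrealRootsIn

/-- Real polynomials with restricted nonreal zeros times `exp (-γ z² + β z)`. -/
def GaussianPoly (ρ : ℝ) (ψ : ℂ → ℂ) : Prop :=
  ∃ (q : ℝ[X]) (γ β : ℝ), 0 ≤ γ ∧ NonrealRootsIn ρ q ∧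
    ∀ z : ℂ, ψ z = aeval z q * Complex.exp (-(γ : ℂ) * z ^ 2 + (β : ℂ) * z)

namespace GaussianPoly

variable {ρ : ℝ} {ψ : ℂ → ℂ}

theorem aeval_derivative_add (q : ℝ[X]) (γ β : ℝ) (z : ℂ) :
    aeval z (derivative q + (C β - C (2 * γ) * X) * q) =
      aeval z (derivative q) + ((β : ℂ) - ((2 * γ : ℝ) : ℂ) * z) * aeval z q := by
  simp only [map_add, map_mul, map_sub, aeval_C, aeval_X, Complex.coe_algebraMap]
  push_cast
  ring

theorem hasDerivAt_mul_exp (q : ℝ[X]) (γ β : ℝ) (z : ℂ) :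
    HasDerivAt (fun z : ℂ => aeval z q * Complex.exp (-(γ : ℂ) * z ^ 2 + (β : ℂ) * z))
      (aeval z (derivative q + (C β - C (2 * γ) * X) * q) *
        Complex.exp (-(γ : ℂ) * z ^ 2 + (β : ℂ) * z)) z := by
  have h1 : HasDerivAt (fun z : ℂ => -(γ : ℂ) * z ^ 2 + (β : ℂ) * z) (-(γ : ℂ) * (2 * z) + β) z := by
    have h2 := ((hasDerivAt_pow 2 z).const_mul (-(γ : ℂ))).fun_add
      ((hasDerivAt_id' z).const_mul (β : ℂ))
    simpa using h2
  have h3 := (q.hasDerivAt_aeval z).fun_mul h1.cexp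
  convert! h3 using 1
  rw [aeval_derivative_add]
  push_cast
  ring

theorem differentiable (h : GaussianPoly ρ ψ) : Differentiable ℂ ψ := by
  obtain ⟨q, γ, β, -, -, h⟩ := h
  rw [funext h]
  exact fun z => (hasDerivAt_mul_exp q γ β z).differentiableAt

theorem conjSymm (h : GaussianPoly ρ ψ) : ConjSymm ψ := by
  obtain ⟨q, γ, β, -, -, h⟩ := h
  intro z
  rw [h, h, aeval_conj_real, map_mul, ← Complex.exp_conj]
  simp

theorem upperNonpos (h : GaussianPoly ρ ψ) (hρ : 0 ≤ ρ) : UpperNonpos (2 * ρ) ψ := by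
  obtain ⟨q, γ, β, hγ, hq, h⟩ := h
  intro z hz hr
  have h0 := hq.aeval_ne_zero hρ hz hr
  rw [funext h, (hasDerivAt_mul_exp q γ β z).deriv, mul_div_mul_right _ _ (Complex.exp_ne_zero _)]
  rw [aeval_derivative_add, add_div, mul_div_assoc, div_self h0, mul_one, Complex.add_im]
  have h1 := (hq.im_logDeriv hρ hz hr).1
  have h2 : ((β : ℂ) - ((2 * γ : ℝ) : ℂ) * z).im = -(2 * γ * z.im) := by
    rw [Complex.sub_im, Complex.im_ofReal_mul, Complex.ofReal_im, zero_sub]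
  rw [h2]
  have : 0 ≤ 2 * γ * z.im := by positivity
  linarith

/-- At an upper zero of the derivative, q'/q = 2γz - β has imaginary part 2γ Im z ≥ 0, while root
pairing makes it ≤ 0. Equality makes q constant and γ = β = 0, the case of a constant ψ. The doubled
radius is the one required by root pairing. -/
theorem deriv (h : GaussianPoly ρ ψ) (hρ : 0 ≤ ρ) :
    GaussianPoly (2 * ρ) (deriv ψ) ∨ deriv ψ = 0 := by
  obtain ⟨q, γ, β, hγ, hq, h⟩ := h
  have hd : ∀ z, _root_.deriv ψ z = aeval z (derivative q + (C β - C (2 * γ) * X) * q) *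
        Complex.exp (-(γ : ℂ) * z ^ 2 + (β : ℂ) * z) := fun z => by
    rw [funext h, (hasDerivAt_mul_exp q γ β z).deriv]
  by_cases hdeg : q.natDegree = 0 ∧ γ = 0 ∧ β = 0
  · right
    obtain ⟨h1, rfl, rfl⟩ := hdeg
    funext z
    rw [hd, eq_C_of_natDegree_eq_zero h1]
    simp
  left
  refine ⟨_, γ, β, hγ, ?_, hd⟩
  have hupper : ∀ z : ℂ, 0 < z.im → 2 * ρ < ‖z‖ →
      aeval z (derivative q + (C β - C (2 * γ) * X) * q) ≠ 0 := by
    intro z hz hr hzero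
    have h0 := hq.aeval_ne_zero hρ hz hr
    have h1 := hq.im_logDeriv hρ hz hr
    rw [aeval_derivative_add] at hzero
    have h2 : aeval z (derivative q) / aeval z q = -((β : ℂ) - ((2 * γ : ℝ) : ℂ) * z) := by
      rw [div_eq_iff h0]
      linear_combination hzero
    have h3 : (-((β : ℂ) - ((2 * γ : ℝ) : ℂ) * z)).im = 2 * γ * z.im := by
      rw [Complex.neg_im, Complex.sub_im, Complex.im_ofReal_mul, Complex.ofReal_im]; ring
    rw [h2, h3] at h1
    have h4 : 0 ≤ 2 * γ * z.im := by positivity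
    have h5 : 2 * γ * z.im = 0 := le_antisymm h1.1 h4
    have h6 : q.natDegree = 0 := h1.2 h5
    have h7 : γ = 0 := by
      rcases mul_eq_zero.1 h5 with h8 | h8
      · linarith
      · exact absurd h8 hz.ne'
    refine hdeg ⟨h6, h7, ?_⟩
    rw [eq_C_of_natDegree_eq_zero h6, h7] at h2
    simpa using h2
  intro z hz
  by_contra hcon
  rw [not_or, not_le] at hcon
  rcases lt_or_gt_of_ne hcon.1 with h1 | h1
  · refine hupper (conj z) (by simpa using h1) (by rw [Complex.norm_conj]; exact hcon.2) ?_
    rw [aeval_conj_real, hz, map_zero]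
  · exact hupper z h1 hcon.2 hz

theorem upperNonpos_deriv (h : GaussianPoly ρ ψ) (hρ : 0 ≤ ρ) :
    UpperNonpos (4 * ρ) (_root_.deriv ψ) := by
  rcases h.deriv hρ with h1 | h1
  · have := h1.upperNonpos (by positivity)
    rwa [← mul_assoc, (by norm_num : (2 : ℝ) * 2 = 4)] at this
  · intro z _ _
    simp [h1]

end GaussianPoly

/-! ### From polynomials to the class L-P* by locally uniform limits -/

theorem UpperNonpos.of_tendsto {ι : Type*} {l : Filter ι} [l.NeBot] {F : ι → ℂ → ℂ} {f : ℂ → ℂ}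
    {r : ℝ} (hF : ∀ i, UpperNonpos r (F i)) (h0 : ∀ z, Tendsto (fun i => F i z) l (𝓝 (f z)))
    (h1 : ∀ z, Tendsto (fun i => deriv (F i) z) l (𝓝 (deriv f z))) : UpperNonpos r f := by
  intro z hz hr
  by_cases hfz : f z = 0
  · simp [hfz]
  · exact le_of_tendsto' ((Complex.continuous_im.tendsto _).comp ((h1 z).div (h0 z) hfz))
      fun i => hF i z hz hr

/-- The first-order terms cancel, since (1 - w)e^w - 1 = (e^w - 1 - w) - w(e^w - 1). The quadratic
bound makes the sum of α_j⁻² suffice for convergence. -/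
theorem norm_primaryFactor_sub_one_le {w : ℂ} (hw : ‖w‖ ≤ 1) :
    ‖(1 - w) * Complex.exp w - 1‖ ≤ 3 * ‖w‖ ^ 2 := by
  have h1 := Complex.norm_exp_sub_one_sub_id_le hw
  have h2 := Complex.norm_exp_sub_one_le hw
  have h3 : (1 - w) * Complex.exp w - 1 = (Complex.exp w - 1 - w) - w * (Complex.exp w - 1) := by
    ring
  rw [h3]
  refine (norm_sub_le _ _).trans ?_
  rw [norm_mul]
  nlinarith [norm_nonneg w]

/-- The canonical product of genus one converges locally uniformly. -/
theorem tendstoLocallyUniformlyOn_primaryFactors {ι : Type*} {α : ι → ℝ}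
    (hsum : Summable fun j => ((α j) ^ 2)⁻¹) {P : ℂ → ℂ}
    (hP : ∀ z : ℂ, HasProd (fun j => (1 - z / (α j : ℂ)) * Complex.exp (z / (α j : ℂ))) (P z)) :
    TendstoLocallyUniformlyOn
      (fun (s : Finset ι) z => ∏ j ∈ s, ((1 - z / (α j : ℂ)) * Complex.exp (z / (α j : ℂ))))
      P atTop Set.univ := by
  rw [tendstoLocallyUniformlyOn_iff_forall_isCompact isOpen_univ]
  intro K _ hK
  obtain ⟨r, hr⟩ := hK.isBounded.exists_norm_le
  have hsmall : ∀ᶠ j in cofinite, r ^ 2 * ((α j) ^ 2)⁻¹ < 1 := by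
    have := (hsum.mul_left (r ^ 2)).tendsto_cofinite_zero
    exact this.eventually_lt_const one_pos
  have h := Summable.hasProdUniformlyOn_one_add (R := ℂ) (K := K)
    (f := fun j z => (1 - z / (α j : ℂ)) * Complex.exp (z / (α j : ℂ)) - 1)
    (u := fun j => 3 * (r ^ 2 * ((α j) ^ 2)⁻¹)) hK ((hsum.mul_left _).mul_left _) ?_ ?_
  · have h2 := h.tendstoUniformlyOn
    simp only [add_sub_cancel] at h2
    exact h2.congr_right fun z _ => (hP z).tprod_eq
  · filter_upwards [hsmall] with j hj z hz
    have h1 : ‖z / (α j : ℂ)‖ ^ 2 ≤ r ^ 2 * ((α j) ^ 2)⁻¹ := by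
      rw [norm_div, div_pow, Complex.norm_real, Real.norm_eq_abs, sq_abs, div_eq_mul_inv]
      have := hr z hz
      gcongr
    refine (norm_primaryFactor_sub_one_le ?_).trans (by gcongr)
    exact (sq_le_one_iff₀ (norm_nonneg _)).1 (h1.trans hj.le)
  · intro j
    fun_prop

theorem exists_rootBound {p : ℝ[X]} (hp : p ≠ 0) :
    ∃ ρ : ℝ, 0 ≤ ρ ∧ ∀ z : ℂ, aeval z p = 0 → ‖z‖ ≤ ρ := by
  have hfin : {z : ℂ | aeval z p = 0}.Finite := by
    refine (p.rootSet_finite ℂ).subset fun z hz => ?_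
    exact mem_rootSet.2 ⟨hp, hz⟩
  obtain ⟨ρ, hρ⟩ := hfin.isBounded.exists_norm_le
  exact ⟨max ρ 0, le_max_right _ _, fun z hz => (hρ z hz).trans (le_max_left _ _)⟩

/-- The properties of the class `L-P*` on which the zero counts rest. -/
theorem laguerrePolyaStar_properties {φ : ℂ → ℂ} (hφ : φ ∈ LaguerrePolyaStar) (h0 : φ ≠ 0) :
    Differentiable ℂ φ ∧ ConjSymm φ ∧ ∃ r : ℝ, UpperNonpos r φ ∧ UpperNonpos r (deriv φ) := by
  obtain ⟨p, f, hp, ⟨c, β, γ, d, ω, α, P, hγ, hα, hsum, hP, hf⟩, hφ⟩ := hφ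
  have hc : c ≠ 0 := by
    rintro rfl
    refine h0 (funext fun z => ?_)
    simp [hφ, hf]
  have hp0 : p ≠ 0 := by
    rintro rfl
    exact hp 0 (by simp)
  obtain ⟨ρ, hρ, hroots⟩ := exists_rootBound hp0
  let E : Finset {j : ℕ // (j : ℕ∞) < ω} → ℂ → ℂ :=
    fun s z => ∏ j ∈ s, ((1 - z / (α j : ℂ)) * Complex.exp (z / (α j : ℂ)))
  let A : ℂ → ℂ := fun z => aeval z p * ((c : ℂ) * z ^ d * Complex.exp (-(γ : ℂ) * z ^ 2 + (β : ℂ) * z))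
  let F : Finset {j : ℕ // (j : ℕ∞) < ω} → ℂ → ℂ := fun s z => A z * E s z
  have hE : TendstoLocallyUniformlyOn E P atTop Set.univ :=
    tendstoLocallyUniformlyOn_primaryFactors hsum hP
  have hEd : ∀ s, Differentiable ℂ (E s) := fun s => by
    show Differentiable ℂ (fun z => ∏ j ∈ s, ((1 - z / (α j : ℂ)) * Complex.exp (z / (α j : ℂ))))
    fun_prop
  have hPd : DifferentiableOn ℂ P Set.univ :=
    hE.differentiableOn (Eventually.of_forall fun s => (hEd s).differentiableOn) isOpen_univ
  have hAd : Differentiable ℂ A := by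
    have := p.differentiable_aeval (𝕜 := ℂ)
    fun_prop
  -- The convergence factors exp(z/α_j) move into the linear exponent β + Σ 1/α_j. It is real, so it
  -- does not affect imaginary parts, and the divergence of Σ 1/α_j is harmless. The linear factors
  -- add only real roots, so ρ depends on p alone.
  have hFG : ∀ s, GaussianPoly ρ (F s) := by
    intro s
    refine ⟨p * (C c * X ^ d * ∏ j ∈ s, (1 - C (α j)⁻¹ * X)), γ, β + ∑ j ∈ s, (α j)⁻¹, hγ, ?_, ?_⟩
    · intro z hz
      simp only [map_mul, aeval_C, map_pow, aeval_X, map_prod, map_sub, map_one,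
        Complex.coe_algebraMap, mul_eq_zero, Finset.prod_eq_zero_iff] at hz
      rcases hz with h1 | (h1 | h1) | ⟨j, hj, h1⟩
      · exact Or.inr (hroots z h1)
      · exact absurd h1 (by exact_mod_cast hc)
      · left
        rw [eq_zero_of_pow_eq_zero h1]
        simp
      · left
        have h2 : z = (α j : ℂ) := by
          have h3 : (α j : ℂ) ≠ 0 := by exact_mod_cast hα j
          rw [Complex.ofReal_inv] at h1
          field_simp at h1
          linear_combination -h1
        simp [h2]
    · intro z
      simp only [F, A, E, map_mul, aeval_C, map_pow, aeval_X, map_prod, map_sub, map_one,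
        Complex.coe_algebraMap, Finset.prod_mul_distrib]
      rw [← Complex.exp_sum]
      have h1 : Complex.exp (-(γ : ℂ) * z ^ 2 + ((β + ∑ j ∈ s, (α j)⁻¹ : ℝ) : ℂ) * z) =
          Complex.exp (-(γ : ℂ) * z ^ 2 + (β : ℂ) * z) * Complex.exp (∑ j ∈ s, z / (α j : ℂ)) := by
        rw [← Complex.exp_add]
        congr 1
        push_cast
        rw [add_mul, Finset.sum_mul, add_assoc]
        congr 2
        exact Finset.sum_congr rfl fun j _ => by rw [div_eq_mul_inv, mul_comm]
      rw [h1]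
      have h2 : ∏ j ∈ s, (1 - z / (α j : ℂ)) = ∏ j ∈ s, (1 - (((α j)⁻¹ : ℝ) : ℂ) * z) :=
        Finset.prod_congr rfl fun j _ => by rw [Complex.ofReal_inv, div_eq_mul_inv, mul_comm]
      rw [h2]
      ring
  have hFφ : TendstoLocallyUniformlyOn F φ atTop Set.univ := by
    have hA : TendstoLocallyUniformlyOn (fun _ : Finset {j : ℕ // (j : ℕ∞) < ω} => A) A atTop
        Set.univ := fun u hu x _ => ⟨Set.univ, univ_mem,
          Eventually.of_forall fun _ y _ => refl_mem_uniformity hu⟩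
    refine ((hA.mul₀ hE hAd.continuous.continuousOn hPd.continuousOn).congr_right ?_)
    intro z _
    simp only [Pi.mul_apply, A, hφ, hf]
    ring
  have hFd : ∀ᶠ s in atTop, DifferentiableOn ℂ (F s) Set.univ :=
    Eventually.of_forall fun s => (hFG s).differentiable.differentiableOn
  have hF' := hFφ.deriv hFd isOpen_univ
  have hF'' := hF'.deriv (Eventually.of_forall fun s =>
    (deriv_entire (hFG s).differentiable).differentiableOn) isOpen_univ
  have t0 : ∀ z, Tendsto (fun s => F s z) atTop (𝓝 (φ z)) :=
    fun z => hFφ.tendsto_at (Set.mem_univ z)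
  have t1 : ∀ z, Tendsto (fun s => deriv (F s) z) atTop (𝓝 (deriv φ z)) :=
    fun z => hF'.tendsto_at (Set.mem_univ z)
  have t2 : ∀ z, Tendsto (fun s => deriv (deriv (F s)) z) atTop (𝓝 (deriv (deriv φ) z)) :=
    fun z => hF''.tendsto_at (Set.mem_univ z)
  -- The radius 4ρ is the one for the derivative; for φ itself 2ρ would do.
  refine ⟨differentiableOn_univ.1 (hFφ.differentiableOn hFd isOpen_univ), fun z => ?_, 4 * ρ,
    fun z hz hr => ?_, ?_⟩
  · refine tendsto_nhds_unique (t0 (conj z)) ?_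
    have := (Complex.continuous_conj.tendsto _).comp (t0 z)
    refine this.congr fun s => ((hFG s).conjSymm z).symm
  · exact UpperNonpos.of_tendsto (fun s => (hFG s).upperNonpos hρ) t0 t1 z hz (by linarith)
  · exact UpperNonpos.of_tendsto (fun s => (hFG s).upperNonpos_deriv hρ) t1 t2

/-! ### The argument principle on a circle -/

theorem exists_entire_factor {f : ℂ → ℂ} (hf : Differentiable ℂ f) {a c : ℂ} {n : ℕ}
    (h : LeadsAt f a n c) :
    ∃ g : ℂ → ℂ, Differentiable ℂ g ∧ g a ≠ 0 ∧ ∀ z, z ≠ a → f z = (z - a) ^ n * g z := by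
  classical
  obtain ⟨hc, g, hg, hga, hfg⟩ := h
  refine ⟨fun z => if z = a then g a else f z / (z - a) ^ n, fun z => ?_, by simp [hga, hc], ?_⟩
  · by_cases hz : z = a
    · subst hz
      refine hg.differentiableAt.congr_of_eventuallyEq ?_
      filter_upwards [eventually_nhdsWithin_iff.1 hfg] with w hw
      by_cases hwz : w = z
      · simp [hwz]
      · have h1 : (w - z) ^ n ≠ 0 := pow_ne_zero _ (sub_ne_zero.2 hwz)
        rw [if_neg hwz, hw hwz, zpow_natCast, mul_div_cancel_left₀ _ h1]
    · have h1 : DifferentiableAt ℂ (fun w => f w / (w - a) ^ n) z :=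
        (hf z).div (by fun_prop) (pow_ne_zero _ (sub_ne_zero.2 hz))
      refine h1.congr_of_eventuallyEq ?_
      filter_upwards [isOpen_ne.mem_nhds hz] with w hw
      exact if_neg hw
  · intro z hz
    have h1 : (z - a) ^ n ≠ 0 := pow_ne_zero _ (sub_ne_zero.2 hz)
    simp only [if_neg hz]
    field_simp

/-- The argument principle for an entire function and a circle. -/
theorem circleIntegral_logDeriv {R : ℝ} (hR : 0 < R) (n : ℂ → ℕ) (Z : Finset ℂ) :
    ∀ {f : ℂ → ℂ}, Differentiable ℂ f →
    (∀ z ∈ Z, z ∈ Metric.ball (0 : ℂ) R ∧ ∃ c, LeadsAt f z (n z) c) →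
    (∀ z ∈ Metric.closedBall (0 : ℂ) R, z ∉ Z → f z ≠ 0) →
    (∮ z in C(0, R), deriv f z / f z) = 2 * Real.pi * Complex.I * ((∑ z ∈ Z, n z : ℕ) : ℂ) := by
  classical
  induction Z using Finset.induction_on with
  | empty =>
    intro f hf _ h
    have hd : DifferentiableOn ℂ (fun z => deriv f z / f z) (Metric.closedBall 0 R) := fun z hz =>
      (logDeriv_analyticAt hf (h z hz (by simp))).differentiableAt.differentiableWithinAt
    have := (hd.diffContOnCl_ball (c := 0) (R := R) subset_rfl).circleIntegral_eq_zero hR.le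
    simpa using this
  | insert a Z haZ ih =>
    intro f hf hZ h
    obtain ⟨haR, c, hc⟩ := hZ a (Finset.mem_insert_self a Z)
    obtain ⟨g, hg, hga, hfg⟩ := exists_entire_factor hf hc
    have hsph : ∀ z ∈ Metric.sphere (0 : ℂ) R, z ≠ a := by
      rintro z hz rfl
      rw [mem_sphere_zero_iff_norm] at hz
      rw [mem_ball_zero_iff] at haR
      linarith
    have hloc : ∀ b, b ≠ a → f =ᶠ[𝓝 b] fun z => (z - a) ^ n a * g z := fun b hb => by
      filter_upwards [isOpen_ne.mem_nhds hb] with z hz using hfg z hz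
    have hgne : ∀ z ∈ Metric.closedBall (0 : ℂ) R, z ∉ Z → g z ≠ 0 := by
      intro z hz hzZ
      by_cases hza : z = a
      · rwa [hza]
      · have h1 := h z hz (by simp [hza, hzZ])
        rw [hfg z hza] at h1
        exact right_ne_zero_of_mul h1
    have hgZ : ∀ z ∈ Z, z ∈ Metric.ball (0 : ℂ) R ∧ ∃ c, LeadsAt g z (n z) c := by
      intro z hz
      obtain ⟨h1, d, hd⟩ := hZ z (Finset.mem_insert_of_mem hz)
      have hza : z ≠ a := by rintro rfl; exact haZ hz
      have h2 : LeadsAt (fun w => (w - a) ^ n a) z 0 ((z - a) ^ n a) :=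
        LeadsAt.of_analyticAt (by fun_prop) (pow_ne_zero _ (sub_ne_zero.2 hza))
      have h3 := hd.div h2
      rw [sub_zero] at h3
      refine ⟨h1, _, h3.congr ?_⟩
      filter_upwards [nhdsWithin_le_nhds (hloc z hza),
        nhdsWithin_le_nhds (isOpen_ne.mem_nhds hza)] with w hw hwa
      rw [hw, mul_div_cancel_left₀ _ (pow_ne_zero _ (sub_ne_zero.2 hwa))]
    have hgs : ∀ z ∈ Metric.sphere (0 : ℂ) R, g z ≠ 0 := fun z hz =>
      hgne z (Metric.sphere_subset_closedBall hz) fun hzZ => by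
        have := (hZ z (Finset.mem_insert_of_mem hzZ)).1
        rw [mem_sphere_zero_iff_norm] at hz
        rw [mem_ball_zero_iff] at this
        linarith
    -- Dividing out the zero a splits off the term n(a)/(z - a), whose integral is 2πi n(a). The
    -- quotient g has only the zeros of the induction hypothesis.
    have hsplit : ∀ z ∈ Metric.sphere (0 : ℂ) R,
        deriv f z / f z = (n a : ℂ) * (z - a)⁻¹ + deriv g z / g z := by
      intro z hz
      have hza := hsph z hz
      have hza' := sub_ne_zero.2 hza
      have h1 : HasDerivAt (fun w => (w - a) ^ n a * g w)
          ((n a * (z - a) ^ (n a - 1) * 1) * g z + (z - a) ^ n a * deriv g z) z :=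
        (((hasDerivAt_id' z).sub_const a).fun_pow (n a)).fun_mul (hg z).hasDerivAt
      have hgz := hgs z hz
      rw [(hloc z hza).deriv_eq, h1.deriv, hfg z hza, add_div,
        mul_div_mul_left _ _ (pow_ne_zero _ hza')]
      congr 1
      rw [mul_div_mul_right _ _ hgz, mul_one]
      rcases Nat.eq_zero_or_pos (n a) with h0 | h0
      · simp [h0]
      · obtain ⟨k, hk⟩ := Nat.exists_eq_add_of_lt h0
        rw [hk]
        simp only [zero_add, Nat.add_sub_cancel]
        field_simp
        ring
    rw [circleIntegral.integral_congr hR.le hsplit, circleIntegral.integral_add,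
      circleIntegral.integral_const_mul, circleIntegral.integral_sub_inv_of_mem_ball haR,
      ih hg hgZ hgne, Finset.sum_insert haZ]
    · push_cast; ring
    · refine ContinuousOn.circleIntegrable hR.le ?_
      exact continuousOn_const.mul ((continuousOn_id.sub continuousOn_const).inv₀
        fun z hz => sub_ne_zero.2 (hsph z hz))
    · refine ContinuousOn.circleIntegrable hR.le fun z hz => ?_
      exact (logDeriv_analyticAt hg (hgs z hz)).continuousAt.continuousWithinAt

/-- The difference is πi for w > 0 and -πi for w < 0. It records how the two branches of the
logarithm used on the two half circles fit together at the real points. -/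
theorem log_I_mul_sub_log_neg_I_mul {w : ℂ} (hw : w.im = 0) (hw0 : w ≠ 0) :
    Complex.log (Complex.I * w) - Complex.log (-Complex.I * w) =
      2 * Real.pi * Complex.I * (((if 0 < w.re then 1 else 0 : ℤ) : ℂ) - 1 / 2) := by
  obtain ⟨x, rfl⟩ : ∃ x : ℝ, w = x := ⟨w.re, Complex.ext rfl (by simpa using hw)⟩
  have hx0 : x ≠ 0 := by exact_mod_cast hw0
  rw [mul_comm, mul_comm (-Complex.I)]
  rcases lt_or_gt_of_ne hx0 with h | h
  · have e1 : (x : ℂ) * Complex.I = ((-x : ℝ) : ℂ) * -Complex.I := by push_cast; ring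
    have e2 : (x : ℂ) * -Complex.I = ((-x : ℝ) : ℂ) * Complex.I := by push_cast; ring
    rw [e1, e2, Complex.log_ofReal_mul (neg_pos.2 h) (by simp),
      Complex.log_ofReal_mul (neg_pos.2 h) (by simp), Complex.log_I, Complex.log_neg_I]
    simp [h.not_gt]
    ring
  · rw [Complex.log_ofReal_mul h (by simp),
      Complex.log_ofReal_mul h (by simp), Complex.log_I, Complex.log_neg_I]
    simp [h]
    ring

/-- Integration of a logarithmic derivative along an arc on which the function stays in a
rotated slit plane. -/
theorem integral_arc_logDeriv {G : ℂ → ℂ} {R a b : ℝ} (hab : a ≤ b) (κ : ℂ) (hκ : κ ≠ 0)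
    (hG : ∀ θ ∈ Set.Icc a b, AnalyticAt ℂ G (circleMap 0 R θ))
    (hs : ∀ θ ∈ Set.Icc a b, κ * G (circleMap 0 R θ) ∈ Complex.slitPlane) :
    ∫ θ in a..b, deriv (circleMap 0 R) θ • (deriv G (circleMap 0 R θ) / G (circleMap 0 R θ)) =
      Complex.log (κ * G (circleMap 0 R b)) - Complex.log (κ * G (circleMap 0 R a)) := by
  refine intervalIntegral.integral_eq_sub_of_hasDerivAt
    (f := fun θ => Complex.log (κ * G (circleMap 0 R θ))) ?_ ?_
  · intro θ hθ
    rw [Set.uIcc_of_le hab] at hθ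
    have h1 : HasDerivAt (fun θ => κ * G (circleMap 0 R θ))
        (κ * (deriv G (circleMap 0 R θ) * deriv (circleMap 0 R) θ)) θ := by
      refine HasDerivAt.const_mul κ ?_
      exact HasDerivAt.comp θ (h₂ := G) (h := circleMap 0 R)
        (hG θ hθ).differentiableAt.hasDerivAt (differentiable_circleMap 0 R θ).hasDerivAt
    have h2 := h1.clog_real (hs θ hθ)
    have h3 : G (circleMap 0 R θ) ≠ 0 := fun h0 => by
      have := hs θ hθ
      rw [h0, mul_zero] at this
      exact Complex.zero_notMem_slitPlane this
    convert! h2 using 1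
    rw [smul_eq_mul]
    field_simp
  · refine ContinuousOn.intervalIntegrable ?_
    rw [Set.uIcc_of_le hab]
    have hc : ContinuousOn (circleMap (0 : ℂ) R) (Set.Icc a b) := (continuous_circleMap 0 R).continuousOn
    intro θ hθ
    have h3 : G (circleMap 0 R θ) ≠ 0 := fun h0 => by
      have := hs θ hθ
      rw [h0, mul_zero] at this
      exact Complex.zero_notMem_slitPlane this
    have h4 : ContinuousAt (fun z => deriv G z / G z) (circleMap 0 R θ) :=
      (hG θ hθ).deriv.continuousAt.div (hG θ hθ).continuousAt h3
    have h5 : ContinuousAt (fun θ => deriv G (circleMap 0 R θ) / G (circleMap 0 R θ)) θ :=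
      ContinuousAt.comp (g := fun z => deriv G z / G z) (f := circleMap 0 R) h4
        (continuous_circleMap 0 R).continuousAt
    have h6 : deriv (circleMap (0 : ℂ) R) = fun θ => circleMap 0 R θ * Complex.I :=
      funext fun θ => deriv_circleMap 0 R θ
    have h7 : ContinuousAt (deriv (circleMap (0 : ℂ) R)) θ := by
      rw [h6]
      exact ((continuous_circleMap 0 R).mul continuous_const).continuousAt
    exact (h7.smul h5).continuousWithinAt

/-- On the upper arc iG lies in the right half-plane, on the lower arc -iG does, so the principal
logarithm is a primitive on each. At ±R these values are nonzero and purely imaginary, hence still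
in the slit plane, and only the mismatch of the branches there contributes. -/
theorem circleIntegral_logDeriv_of_half_planes {G : ℂ → ℂ} {R : ℝ} (hR : 0 < R)
    (hG : ∀ z ∈ Metric.sphere (0 : ℂ) R, AnalyticAt ℂ G z)
    (hs : ConjSymm G) (him : ∀ z ∈ Metric.sphere (0 : ℂ) R, 0 < z.im → (G z).im < 0)
    (h1 : G (R : ℝ) ≠ 0) (h2 : G ((-R : ℝ) : ℂ) ≠ 0) :
    (∮ z in C(0, R), deriv G z / G z) =
      2 * Real.pi * Complex.I * ((posInd G (-R) : ℂ) - (posInd G R : ℂ)) := by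
  have hpi := Real.pi_pos
  have hmem : ∀ θ, circleMap 0 R θ ∈ Metric.sphere (0 : ℂ) R := fun θ =>
    circleMap_mem_sphere 0 hR.le θ
  have him_circle : ∀ θ, (circleMap 0 R θ).im = R * Real.sin θ := fun θ => by
    rw [circleMap_zero, Complex.im_ofReal_mul, Complex.exp_ofReal_mul_I_im]
  have e0 : circleMap 0 R 0 = ((R : ℝ) : ℂ) := by simp [circleMap]
  have e1 : circleMap 0 R Real.pi = ((-R : ℝ) : ℂ) := by simp [circleMap]
  have e2 : circleMap 0 R (2 * Real.pi) = ((R : ℝ) : ℂ) := by simp [circleMap]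
  have r1 := hs.im_eq_zero R
  have r2 := hs.im_eq_zero (-R)
  have re1 : (G (R : ℝ)).re ≠ 0 := fun h => h1 (Complex.ext h r1)
  have re2 : (G ((-R : ℝ) : ℂ)).re ≠ 0 := fun h => h2 (Complex.ext h r2)
  have hup : ∀ θ ∈ Set.Icc 0 Real.pi, Complex.I * G (circleMap 0 R θ) ∈ Complex.slitPlane := by
    intro θ hθ
    rw [Complex.mem_slitPlane_iff]
    rcases hθ.1.eq_or_lt with h | h
    · right
      rw [← h, e0]
      simpa using re1
    rcases hθ.2.eq_or_lt with h' | h'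
    · right
      rw [h', e1]
      simpa using re2
    · left
      have h3 := him _ (hmem θ) (by
        rw [him_circle]; exact mul_pos hR (Real.sin_pos_of_pos_of_lt_pi h h'))
      simpa using h3
  have hlow : ∀ θ ∈ Set.Icc Real.pi (2 * Real.pi),
      -Complex.I * G (circleMap 0 R θ) ∈ Complex.slitPlane := by
    intro θ hθ
    rw [Complex.mem_slitPlane_iff]
    rcases hθ.1.eq_or_lt with h | h
    · right
      rw [← h, e1]
      simpa using re2
    rcases hθ.2.eq_or_lt with h' | h'
    · right
      rw [h', e2]
      simpa using re1
    · left
      have hsin : Real.sin θ < 0 := by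
        have h4 := Real.sin_pos_of_pos_of_lt_pi (x := θ - Real.pi) (by linarith) (by linarith)
        rw [Real.sin_sub_pi] at h4
        linarith
      have h3 := him (conj (circleMap 0 R θ)) (by
        rw [mem_sphere_zero_iff_norm, Complex.norm_conj]
        exact mem_sphere_zero_iff_norm.1 (hmem θ)) (by
        rw [Complex.conj_im, him_circle]
        nlinarith)
      rw [hs, Complex.conj_im] at h3
      simp
      linarith
  have hcont : ∀ a b, IntervalIntegrable (fun θ => deriv (circleMap 0 R) θ •
      (deriv G (circleMap 0 R θ) / G (circleMap 0 R θ))) MeasureTheory.volume a b := by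
    intro a b
    have hne : ∀ z ∈ Metric.sphere (0 : ℂ) R, G z ≠ 0 := by
      intro z hz h0
      rcases lt_trichotomy z.im 0 with h | h | h
      · have h3 := him (conj z) (by
          rw [mem_sphere_zero_iff_norm, Complex.norm_conj]
          exact mem_sphere_zero_iff_norm.1 hz) (by rw [Complex.conj_im]; linarith)
        rw [hs, h0] at h3
        simp at h3
      · have hz' : z = (z.re : ℂ) := Complex.ext rfl (by simpa using h)
        rw [mem_sphere_zero_iff_norm, hz', Complex.norm_real, Real.norm_eq_abs] at hz
        rcases abs_eq hR.le |>.1 hz with h5 | h5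
        · rw [h5] at hz'
          exact h1 (hz' ▸ h0)
        · rw [h5] at hz'
          exact h2 (hz' ▸ h0)
      · have h3 := him z hz h
        rw [h0] at h3
        simp at h3
    have hc : Continuous fun θ => deriv G (circleMap 0 R θ) / G (circleMap 0 R θ) := by
      rw [continuous_iff_continuousAt]
      intro θ
      have h4 : ContinuousAt (fun z => deriv G z / G z) (circleMap 0 R θ) :=
        (hG _ (hmem θ)).deriv.continuousAt.div (hG _ (hmem θ)).continuousAt (hne _ (hmem θ))
      exact ContinuousAt.comp (g := fun z => deriv G z / G z) (f := circleMap 0 R) h4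
        (continuous_circleMap 0 R).continuousAt
    have h6 : deriv (circleMap (0 : ℂ) R) = fun θ => circleMap 0 R θ * Complex.I :=
      funext fun θ => deriv_circleMap 0 R θ
    rw [h6]
    exact (((continuous_circleMap 0 R).mul continuous_const).smul hc).intervalIntegrable a b
  rw [circleIntegral, ← intervalIntegral.integral_add_adjacent_intervals (b := Real.pi)
    (hcont _ _) (hcont _ _),
    integral_arc_logDeriv hpi.le Complex.I Complex.I_ne_zero (fun θ _ => hG _ (hmem θ)) hup,
    integral_arc_logDeriv (by linarith) (-Complex.I) (by simp) (fun θ _ => hG _ (hmem θ)) hlow,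
    e0, e1, e2]
  have l1 := log_I_mul_sub_log_neg_I_mul r1 h1
  have l2 := log_I_mul_sub_log_neg_I_mul r2 h2
  unfold posInd
  linear_combination l2 - l1

/-- Outside the zeros of `f` and `f'`, the logarithmic derivative of `f' / f` is
`f'' / f' - f' / f`. -/
theorem logDeriv_logDeriv {f : ℂ → ℂ} (hf : Differentiable ℂ f) {z : ℂ} (h0 : f z ≠ 0)
    (h1 : deriv f z ≠ 0) :
    logDerivDeriv f z / (deriv f z / f z) = deriv (deriv f) z / deriv f z - deriv f z / f z := by
  have h2 := ((deriv_entire hf) z).hasDerivAt.fun_div (hf z).hasDerivAt h0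
  unfold logDerivDeriv
  rw [h2.deriv]
  field_simp

/-- Comparison of the numbers of zeros of `f'` and `f` in a disc. -/
theorem sum_orders_sub {f : ℂ → ℂ} (hf : Differentiable ℂ f) (hs : ConjSymm f) {R : ℝ} (hR : 0 < R)
    (n n' : ℂ → ℕ) (Z : Finset ℂ)
    (hZ : ∀ z ∈ Z, z ∈ Metric.ball (0 : ℂ) R ∧ (∃ c, LeadsAt f z (n z) c) ∧
      ∃ c, LeadsAt (deriv f) z (n' z) c)
    (hne : ∀ z ∈ Metric.closedBall (0 : ℂ) R, z ∉ Z → f z ≠ 0)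
    (hne' : ∀ z ∈ Metric.closedBall (0 : ℂ) R, z ∉ Z → deriv f z ≠ 0)
    (him : ∀ z ∈ Metric.sphere (0 : ℂ) R, 0 < z.im → (deriv f z / f z).im < 0) :
    ∑ z ∈ Z, ((n' z : ℤ) - n z) =
      posInd (fun z => deriv f z / f z) (-R) - posInd (fun z => deriv f z / f z) R := by
  have hnot : ∀ z ∈ Metric.sphere (0 : ℂ) R, z ∉ Z := fun z hz hzZ => by
    have h1 := (hZ z hzZ).1
    rw [mem_sphere_zero_iff_norm] at hz
    rw [mem_ball_zero_iff] at h1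
    linarith
  have h0 : ∀ z ∈ Metric.sphere (0 : ℂ) R, f z ≠ 0 := fun z hz =>
    hne z (Metric.sphere_subset_closedBall hz) (hnot z hz)
  have h0' : ∀ z ∈ Metric.sphere (0 : ℂ) R, deriv f z ≠ 0 := fun z hz =>
    hne' z (Metric.sphere_subset_closedBall hz) (hnot z hz)
  have hRs : ((R : ℝ) : ℂ) ∈ Metric.sphere (0 : ℂ) R := by
    rw [mem_sphere_zero_iff_norm, Complex.norm_real, Real.norm_eq_abs, abs_of_pos hR]
  have hRs' : ((-R : ℝ) : ℂ) ∈ Metric.sphere (0 : ℂ) R := by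
    rw [mem_sphere_zero_iff_norm, Complex.norm_real, Real.norm_eq_abs, abs_neg, abs_of_pos hR]
  have e1 := circleIntegral_logDeriv_of_half_planes hR (G := fun z => deriv f z / f z)
    (fun z hz => logDeriv_analyticAt hf (h0 z hz)) (hs.deriv.div hs) him
    (div_ne_zero (h0' _ hRs) (h0 _ hRs)) (div_ne_zero (h0' _ hRs') (h0 _ hRs'))
  have e2 := circleIntegral_logDeriv hR n Z hf (fun z hz => ⟨(hZ z hz).1, (hZ z hz).2.1⟩) hne
  have e3 := circleIntegral_logDeriv hR n' Z (deriv_entire hf)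
    (fun z hz => ⟨(hZ z hz).1, (hZ z hz).2.2⟩) hne'
  have e4 : (∮ z in C(0, R), deriv (fun z => deriv f z / f z) z / (deriv f z / f z)) =
      (∮ z in C(0, R), deriv (deriv f) z / deriv f z) - ∮ z in C(0, R), deriv f z / f z := by
    rw [← circleIntegral.integral_sub]
    · exact circleIntegral.integral_congr hR.le fun z hz => logDeriv_logDeriv hf (h0 z hz) (h0' z hz)
    · exact ContinuousOn.circleIntegrable hR.le fun z hz =>
        (logDeriv_analyticAt (deriv_entire hf) (h0' z hz)).continuousAt.continuousWithinAt
    · exact ContinuousOn.circleIntegrable hR.le fun z hz =>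
        (logDeriv_analyticAt hf (h0 z hz)).continuousAt.continuousWithinAt
  rw [e1, e2, e3, ← mul_sub] at e4
  have e5 := mul_left_cancel₀ Complex.two_pi_I_ne_zero e4
  have e6 : (((∑ z ∈ Z, ((n' z : ℤ) - n z) : ℤ)) : ℂ) =
      ((posInd (fun z => deriv f z / f z) (-R) - posInd (fun z => deriv f z / f z) R : ℤ) : ℂ) := by
    push_cast at e5 ⊢
    rw [e5, Finset.sum_sub_distrib]
  exact_mod_cast e6

/-! ### Local orders of L, Q and D -/

/-- The quotient `Q / L` of the derivative of `L = f' / f` by `L`. -/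
noncomputable def derivRatio (f : ℂ → ℂ) : ℂ → ℂ := fun z => logDerivDeriv f z / (deriv f z / f z)

/-- The order of `Q[f]` at `z` as an integer. -/
noncomputable def ordQ (f : ℂ → ℂ) (z : ℂ) : ℤ := (meromorphicOrderAt (logDerivDeriv f) z).untop₀

theorem LeadsAt.order_unique {F : ℂ → ℂ} {z c d : ℂ} {n k : ℤ} (h : LeadsAt F z n c)
    (h' : LeadsAt F z k d) : n = k := by
  have := h.order.symm.trans h'.order
  exact_mod_cast this

theorem LeadsAt.ordQ_eq {f : ℂ → ℂ} {z c : ℂ} {n : ℤ} (h : LeadsAt (logDerivDeriv f) z n c) :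
    ordQ f z = n := by
  rw [ordQ, h.order]
  rfl

theorem leadsAt_analyticOrderNatAt {f : ℂ → ℂ} (hf : Differentiable ℂ f) (h0 : f ≠ 0) (z : ℂ) :
    ∃ c, LeadsAt f z (analyticOrderNatAt f z) c := by
  obtain ⟨n, c, hc, -⟩ := order_natCast_of_ne_zero hf h0 z
  have h1 := hc.order
  rw [(hf.analyticAt z).meromorphicOrderAt_eq] at h1
  have h2 : analyticOrderAt f z = n := by
    cases h : analyticOrderAt f z with
    | top => rw [h] at h1; exact absurd h1 (by simp)
    | coe k =>
      rw [h] at h1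
      have h3 : ((k : ℤ) : WithTop ℤ) = ((n : ℤ) : WithTop ℤ) := h1
      have h4 : k = n := by exact_mod_cast h3
      rw [h4]
  refine ⟨c, ?_⟩
  rwa [analyticOrderNatAt, h2]

theorem analyticOrderNatAt_eq_zero_of {f : ℂ → ℂ} (hf : Differentiable ℂ f) {z : ℂ} (h : f z ≠ 0) :
    analyticOrderNatAt f z = 0 := by
  rw [analyticOrderNatAt, (hf.analyticAt z).analyticOrderAt_eq_zero.2 h]
  rfl

theorem analyticOrderNatAt_ne_zero_of {f : ℂ → ℂ} (hf : Differentiable ℂ f) (h0 : f ≠ 0) {z : ℂ}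
    (h : f z = 0) : analyticOrderNatAt f z ≠ 0 := by
  intro hn
  obtain ⟨n, c, hc, h1⟩ := order_natCast_of_ne_zero hf h0 z
  obtain ⟨d, hd⟩ := leadsAt_analyticOrderNatAt hf h0 z
  have h2 := hd.order_unique hc
  rw [hn] at h2
  exact h1.1 (by exact_mod_cast h2.symm) h

theorem logDerivDeriv_analyticAt {f : ℂ → ℂ} (hf : Differentiable ℂ f) {z : ℂ} (hz : f z ≠ 0) :
    AnalyticAt ℂ (logDerivDeriv f) z := (logDeriv_analyticAt hf hz).deriv

theorem logDerivDeriv_conjSymm {f : ℂ → ℂ} (hs : ConjSymm f) : ConjSymm (logDerivDeriv f) :=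
  (hs.deriv.div hs).deriv

theorem derivRatio_conjSymm {f : ℂ → ℂ} (hs : ConjSymm f) : ConjSymm (derivRatio f) :=
  (logDerivDeriv_conjSymm hs).div (hs.deriv.div hs)

theorem meromorphicAt_logDerivDeriv {f : ℂ → ℂ} (hf : Differentiable ℂ f) (z : ℂ) :
    MeromorphicAt (logDerivDeriv f) z :=
  ((hf.analyticAt z).deriv.meromorphicAt.div (hf.analyticAt z).meromorphicAt).deriv

/-- If `Q[f]` does not vanish identically, it has a leading term everywhere. -/
theorem leadsAt_ordQ {f : ℂ → ℂ} (hf : Differentiable ℂ f) {z₀ : ℂ} (h0 : f z₀ ≠ 0)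
    (hQ : logDerivDeriv f z₀ ≠ 0) (z : ℂ) : ∃ c, LeadsAt (logDerivDeriv f) z (ordQ f z) c := by
  have hm : MeromorphicOn (logDerivDeriv f) Set.univ := fun w _ => meromorphicAt_logDerivDeriv hf w
  have h1 : meromorphicOrderAt (logDerivDeriv f) z₀ ≠ ⊤ := by
    rw [(LeadsAt.of_analyticAt (logDerivDeriv_analyticAt hf h0) hQ).order]
    exact WithTop.coe_ne_top
  have h2 : meromorphicOrderAt (logDerivDeriv f) z ≠ ⊤ :=
    hm.meromorphicOrderAt_ne_top_of_isPreconnected isPreconnected_univ (Set.mem_univ z₀)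
      (Set.mem_univ z) h1
  refine LeadsAt.exists_of_order (meromorphicAt_logDerivDeriv hf z) ?_
  rw [ordQ, WithTop.coe_untop₀_of_ne_top h2]

theorem ordQ_nonneg {f : ℂ → ℂ} (hf : Differentiable ℂ f) {z : ℂ} (h0 : f z ≠ 0) : 0 ≤ ordQ f z := by
  have := (logDerivDeriv_analyticAt hf h0).meromorphicOrderAt_nonneg
  rw [ordQ]
  cases h : meromorphicOrderAt (logDerivDeriv f) z with
  | top => simp
  | coe n =>
    rw [h] at this
    simpa using this

section Local

variable {f : ℂ → ℂ}

theorem leadsAt_Q_of_zero (hf : Differentiable ℂ f) (h0 : f ≠ 0) {z : ℂ} (hz : f z = 0) :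
    LeadsAt (logDerivDeriv f) z (-2) (-(analyticOrderNatAt f z : ℂ)) := by
  obtain ⟨c, hc⟩ := leadsAt_analyticOrderNatAt hf h0 z
  have h1 := hc.logDeriv (by exact_mod_cast analyticOrderNatAt_ne_zero_of hf h0 hz)
  have h2 := h1.deriv (by norm_num)
  simpa using! h2

theorem orders_of_zero (hf : Differentiable ℂ f) (h0 : f ≠ 0) (h0' : deriv f ≠ 0) {z : ℂ} (hz : f z = 0) :
    (analyticOrderNatAt (deriv f) z : ℤ) - analyticOrderNatAt f z = -1 := by
  obtain ⟨c, hc⟩ := leadsAt_analyticOrderNatAt hf h0 z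
  obtain ⟨d, hd⟩ := leadsAt_analyticOrderNatAt (deriv_entire hf) h0' z
  have h1 := hc.deriv (by exact_mod_cast analyticOrderNatAt_ne_zero_of hf h0 hz)
  have h2 := hd.order_unique h1
  omega

/-- D is the logarithmic derivative of L, so its residue is the order of L, which is -1 at every
zero of f whatever the multiplicity. -/
theorem leadsAt_derivRatio_of_zero (hf : Differentiable ℂ f) (h0 : f ≠ 0) (h0' : deriv f ≠ 0) {z : ℂ} (hz : f z = 0) :
    LeadsAt (derivRatio f) z (-1) (-1) := by
  obtain ⟨c, hc⟩ := leadsAt_analyticOrderNatAt hf h0 z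
  obtain ⟨d, hd⟩ := leadsAt_analyticOrderNatAt (deriv_entire hf) h0' z
  have h1 := orders_of_zero hf h0 h0' hz
  have h2 := hd.div hc
  rw [h1] at h2
  have h3 := h2.logDeriv (by norm_num)
  simpa using! h3

/-- Here L vanishes to the order of f', which is therefore the residue of D; L' vanishes to one
order less. -/
theorem leadsAt_of_critical (hf : Differentiable ℂ f) (h0' : deriv f ≠ 0) {z : ℂ} (hz : f z ≠ 0) (hz' : deriv f z = 0) :
    LeadsAt (derivRatio f) z (-1) (analyticOrderNatAt (deriv f) z) ∧
      ordQ f z = analyticOrderNatAt (deriv f) z - 1 := by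
  obtain ⟨d, hd⟩ := leadsAt_analyticOrderNatAt (deriv_entire hf) h0' z
  have h2 := hd.div (LeadsAt.of_analyticAt (hf.analyticAt z) hz)
  rw [sub_zero] at h2
  have hne : ((analyticOrderNatAt (deriv f) z : ℕ) : ℤ) ≠ 0 := by
    exact_mod_cast analyticOrderNatAt_ne_zero_of (deriv_entire hf) h0' hz'
  have h3 := h2.logDeriv hne
  refine ⟨by simpa using! h3, ?_⟩
  exact LeadsAt.ordQ_eq (h2.deriv hne)

theorem leadsAt_of_regular (hf : Differentiable ℂ f) (hs : ConjSymm f) {z₀ : ℂ} (hz₀ : f z₀ ≠ 0) (hQ : logDerivDeriv f z₀ ≠ 0) {x : ℝ}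
    (hx : f x ≠ 0) (hx' : deriv f x ≠ 0) :
    ∃ c : ℝ, LeadsAt (derivRatio f) x (ordQ f x) c := by
  obtain ⟨c, hc⟩ := leadsAt_ordQ hf hz₀ hQ x
  have h1 := hc.div (LeadsAt.of_analyticAt (logDeriv_analyticAt hf hx) (div_ne_zero hx' hx))
  rw [sub_zero] at h1
  obtain ⟨c', hc'⟩ := LeadsAt.coeff_real (F := derivRatio f) h1
    (Eventually.of_forall fun y => (derivRatio_conjSymm hs).im_eq_zero y)
  exact ⟨c', hc' ▸ h1⟩

/-! ### The local inequality for the lower bound -/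

theorem neg_one_le_signJump (n : ℤ) (c : ℝ) : -1 ≤ signJump n c := by
  unfold signJump
  split_ifs <;> norm_num

/-- At every real point, the order of `L = f' / f` minus the number of zeros of `L'` is bounded by
the jump of the sign of `L' / L`. -/
theorem order_sub_le_jump (hf : Differentiable ℂ f) (hs : ConjSymm f) (h0' : deriv f ≠ 0)
    {z₀ : ℂ} (hz₀ : f z₀ ≠ 0) (hQ : logDerivDeriv f z₀ ≠ 0) (x : ℝ) :
    ∃ (d : ℤ) (c : ℝ), LeadsAt (derivRatio f) x d c ∧
      (analyticOrderNatAt (deriv f) x : ℤ) - analyticOrderNatAt f x - (ordQ f x).toNat ≤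
        signJump d c := by
  have h0 : f ≠ 0 := fun h => hz₀ (by rw [h]; rfl)
  by_cases hx : f x = 0
  · refine ⟨-1, -1, by simpa using leadsAt_derivRatio_of_zero hf h0 h0' hx, ?_⟩
    have h1 := orders_of_zero hf h0 h0' hx
    have h2 := neg_one_le_signJump (-1) (-1)
    omega
  by_cases hx' : deriv f x = 0
  · obtain ⟨h1, h2⟩ := leadsAt_of_critical hf h0' hx hx'
    refine ⟨-1, analyticOrderNatAt (deriv f) x, by simpa using h1, ?_⟩
    have h3 := analyticOrderNatAt_eq_zero_of hf hx
    have h4 := analyticOrderNatAt_ne_zero_of (deriv_entire hf) h0' hx'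
    have h5 : signJump (-1) (analyticOrderNatAt (deriv f) x) = 1 := by
      have : (0 : ℝ) < analyticOrderNatAt (deriv f) x := by exact_mod_cast Nat.pos_of_ne_zero h4
      simp [signJump, this]
    omega
  · obtain ⟨c, hc⟩ := leadsAt_of_regular hf hs hz₀ hQ hx hx'
    refine ⟨_, c, hc, ?_⟩
    have h3 := analyticOrderNatAt_eq_zero_of hf hx
    have h4 := analyticOrderNatAt_eq_zero_of (deriv_entire hf) hx'
    have h5 := ordQ_nonneg hf hx
    by_cases h6 : ordQ f x = 0
    · rw [h3, h4, h6]
      simp [signJump]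
    · have h2 := neg_one_le_signJump (ordQ f x) c
      omega

/-! ### The local inequality for the upper bound -/

/-- Where `f` and `f'` do not vanish, `D' + L D = Q₁`; a zero of `D` determines the leading term
of `Q₁`. -/
theorem leadsAt_Q_deriv_of_zero_of_derivRatio (hf : Differentiable ℂ f) {z c : ℂ} {k : ℤ}
    (hz : f z ≠ 0) (hz' : deriv f z ≠ 0) (hk : k ≠ 0) (h : LeadsAt (derivRatio f) z k c) :
    LeadsAt (logDerivDeriv (deriv f)) z (k - 1) (k * c) := by
  have hL := logDeriv_analyticAt hf hz
  have h1 := h.deriv hk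
  obtain ⟨hc, g, hg, hgz, hfg⟩ := h
  have h2 : LeadsAt (fun w => deriv (derivRatio f) w + (deriv f w / f w) * derivRatio f w) z
      (k - 1) (k * c) := by
    refine h1.add_higher (h := fun w => (deriv f w / f w) * g w) (hL.mul hg) ?_
    filter_upwards [hfg] with w hw
    rw [hw, sub_add_cancel]
    ring
  refine h2.congr (Filter.EventuallyEq.filter_mono ?_ nhdsWithin_le_nhds)
  -- The identity f''/f' = L + D holds on a neighbourhood, so it can be differentiated: Q₁ = D' +
  -- L', with L' = LD. The term LD has order at least k and does not disturb the leading term of D'.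
  have he : ∀ᶠ w in 𝓝 z, f w ≠ 0 ∧ deriv f w ≠ 0 :=
    (hf.continuous.continuousAt.eventually_ne hz).and
      ((deriv_entire hf).continuous.continuousAt.eventually_ne hz')
  filter_upwards [he.eventually_nhds] with w hw
  obtain ⟨hw0, hw1⟩ := hw.self_of_nhds
  have e1 : (fun u => derivRatio f u + deriv f u / f u) =ᶠ[𝓝 w]
      fun u => deriv (deriv f) u / deriv f u := by
    filter_upwards [hw] with u hu
    rw [derivRatio, logDeriv_logDeriv hf hu.1 hu.2]
    ring
  have hLw := logDeriv_analyticAt hf hw0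
  have hDw : AnalyticAt ℂ (derivRatio f) w :=
    (logDerivDeriv_analyticAt hf hw0).div hLw (div_ne_zero hw1 hw0)
  have e2 : logDerivDeriv (deriv f) w = deriv (derivRatio f) w + logDerivDeriv f w := by
    rw [logDerivDeriv, ← e1.deriv_eq]
    exact deriv_fun_add hDw.differentiableAt hLw.differentiableAt
  have e3 : logDerivDeriv f w = (deriv f w / f w) * derivRatio f w := by
    rw [derivRatio, mul_div_cancel₀ _ (div_ne_zero hw1 hw0)]
  rw [e2, e3]

theorem leadsAt_ordQ_real (hf : Differentiable ℂ f) (hs : ConjSymm f) {z₀ : ℂ}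
    (hz₀ : f z₀ ≠ 0) (hQ : logDerivDeriv f z₀ ≠ 0) (x : ℝ) :
    ∃ c : ℝ, LeadsAt (logDerivDeriv f) x (ordQ f x) c := by
  obtain ⟨c, hc⟩ := leadsAt_ordQ hf hz₀ hQ x
  obtain ⟨c', hc'⟩ := hc.coeff_real
    (Eventually.of_forall fun y => (logDerivDeriv_conjSymm hs).im_eq_zero y)
  exact ⟨c', hc' ▸ hc⟩

theorem signJump_odd_pos {n : ℤ} (hn : Odd n) {c : ℝ} (hc : 0 < c) : signJump n c = 1 := by
  simp [signJump, Int.not_even_iff_odd.2 hn, hc]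

theorem signJump_even {n : ℤ} (hn : Even n) (c : ℝ) : signJump n c = 0 := by
  simp [signJump, hn]

/-- The product `D * Q₁`, whose sign changes are counted for the upper bound. -/
noncomputable def ratioMulQ (f : ℂ → ℂ) : ℂ → ℂ :=
  fun z => derivRatio f z * logDerivDeriv (deriv f) z

/-- The exceptional simple zeros of `f`, at which `Q₁` is positive. -/
def IsExceptional (f : ℂ → ℂ) (x : ℝ) : Prop :=
  f x = 0 ∧ deriv f x ≠ 0 ∧ 0 < (logDerivDeriv (deriv f) x).re

/-- With n' the order of f', D has leading term n'/(z - x) and Q₁ has -n'/(z - x)². The product thus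
passes from positive to negative, which fixes the signs next to the ends of the intervals in
property A. -/
theorem leadsAt_ratioMulQ_of_critical (hf : Differentiable ℂ f) (h0' : deriv f ≠ 0) {x : ℝ}
    (hx : f x ≠ 0) (hx' : deriv f x = 0) :
    ∃ c : ℝ, c < 0 ∧ LeadsAt (ratioMulQ f) x (-3) c := by
  have h1 := (leadsAt_of_critical hf h0' hx hx').1
  have h2 := leadsAt_Q_of_zero (deriv_entire hf) h0' hx'
  have h4 := analyticOrderNatAt_ne_zero_of (deriv_entire hf) h0' hx'
  refine ⟨-((analyticOrderNatAt (deriv f) x : ℝ) ^ 2), ?_, ?_⟩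
  · have : (0 : ℝ) < analyticOrderNatAt (deriv f) x := by exact_mod_cast Nat.pos_of_ne_zero h4
    have := pow_pos this 2
    linarith
  · have h5 := h1.mul h2
    norm_num at h5
    have e : ((-((analyticOrderNatAt (deriv f) x : ℝ) ^ 2) : ℝ) : ℂ) =
      -((analyticOrderNatAt (deriv f) x : ℂ) * analyticOrderNatAt (deriv f) x) := by
      push_cast; ring
    rw [e]
    exact h5

theorem IsExceptional.leadsAt (hf : Differentiable ℂ f) (hs : ConjSymm f) (h0 : f ≠ 0)
    (h0' : deriv f ≠ 0) {x : ℝ} (h : IsExceptional f x) :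
    ∃ c : ℝ, c < 0 ∧ LeadsAt (ratioMulQ f) x (-1) c := by
  obtain ⟨hx, hx', hpos⟩ := h
  have h1 := leadsAt_derivRatio_of_zero hf h0 h0' hx
  have h2 := LeadsAt.of_analyticAt (logDerivDeriv_analyticAt (deriv_entire hf) hx')
    (fun h => by rw [h] at hpos; simp at hpos)
  have h3 := h1.mul h2
  have e : logDerivDeriv (deriv f) x = ((logDerivDeriv (deriv f) x).re : ℂ) :=
    Complex.ext (by simp) (by simpa using (logDerivDeriv_conjSymm hs.deriv).im_eq_zero x)
  refine ⟨-(logDerivDeriv (deriv f) x).re, by linarith, ?_⟩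
  rw [add_zero, e] at h3
  have e2 : ((-(logDerivDeriv (deriv f) x).re : ℝ) : ℂ) =
      -1 * ((logDerivDeriv (deriv f) x).re : ℂ) := by push_cast; ring
  rw [e2]
  exact h3

/-- The local inequality behind the upper bound. -/
theorem ratioMulQ_local (hf : Differentiable ℂ f) (hs : ConjSymm f) {z₀ : ℂ} (hz₀ : f z₀ ≠ 0)
    (hQ : logDerivDeriv f z₀ ≠ 0) (hz₀' : deriv f z₀ ≠ 0)
    (hQ' : logDerivDeriv (deriv f) z₀ ≠ 0) (x : ℝ) :
    ∃ (e : ℤ) (c : ℝ), LeadsAt (ratioMulQ f) x e c ∧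
      ((ordQ f x).toNat - (ordQ (deriv f) x).toNat -
          ((analyticOrderNatAt (deriv f) x : ℤ) - analyticOrderNatAt f x) ≤ signJump e c ∨
        IsExceptional f x ∧ (ordQ f x).toNat - (ordQ (deriv f) x).toNat -
          ((analyticOrderNatAt (deriv f) x : ℤ) - analyticOrderNatAt f x) - 2 ≤ signJump e c) := by
  have h0 : f ≠ 0 := fun h => hz₀ (by rw [h]; rfl)
  have h0' : deriv f ≠ 0 := fun h => hz₀' (by rw [h]; rfl)
  have hf' := deriv_entire hf
  by_cases hx : f x = 0
  · have h1 := leadsAt_derivRatio_of_zero hf h0 h0' hx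
    have h2 := orders_of_zero hf h0 h0' hx
    have h3 := (leadsAt_Q_of_zero hf h0 hx).ordQ_eq
    by_cases hx' : deriv f x = 0
    · have h4 := leadsAt_Q_of_zero hf' h0' hx'
      have h5 := h4.ordQ_eq
      -- Multiple zero of f: the two negative leading coefficients multiply to a positive one, at
      -- order -3. Both sides of the inequality equal 1.
      refine ⟨-1 + -2, analyticOrderNatAt (deriv f) x, by simpa using! h1.mul h4, Or.inl ?_⟩
      have h6 := analyticOrderNatAt_ne_zero_of hf' h0' hx'
      rw [signJump_odd_pos (by decide) (by exact_mod_cast Nat.pos_of_ne_zero h6)]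
      omega
    · obtain ⟨c, hc⟩ := leadsAt_ordQ_real hf' hs.deriv hz₀' hQ' x
      have h5 := ordQ_nonneg hf' hx'
      have h6 : LeadsAt (ratioMulQ f) x (-1 + ordQ (deriv f) x) ((-c : ℝ) : ℂ) := by
        simpa using! h1.mul hc
      by_cases hexc : IsExceptional f x
      -- For Q₁ > 0 the left side is 1 while the jump is -1: the deficit of 2 that property A has to
      -- repair.
      · refine ⟨_, _, h6, Or.inr ⟨hexc, ?_⟩⟩
        have h7 := neg_one_le_signJump (-1 + ordQ (deriv f) x) (-c)
        omega
      · refine ⟨_, _, h6, Or.inl ?_⟩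
        have h7 := neg_one_le_signJump (-1 + ordQ (deriv f) x) (-c)
        -- With k the order of Q₁ at the simple zero, the left side is 1 - k. For k = 0, Q₁ is
        -- negative and the jump is 1; for k = 1 the product has order 0 and no jump; for k ≥ 2
        -- every jump is large enough.
        by_cases h8 : ordQ (deriv f) x = 0
        · have ha := logDerivDeriv_analyticAt hf' hx'
          rw [h8] at hc
          obtain ⟨hc0, g, hg, hgx, hfg⟩ := hc
          have h9 : logDerivDeriv (deriv f) x = c := by
            rw [← hgx]
            have h10 : logDerivDeriv (deriv f) =ᶠ[𝓝[≠] (x : ℂ)] g := by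
              filter_upwards [hfg] with w hw
              rw [hw, zpow_zero, one_mul]
            exact tendsto_nhds_unique
              ((ha.continuousAt.tendsto.mono_left nhdsWithin_le_nhds).congr' h10)
              (hg.continuousAt.tendsto.mono_left nhdsWithin_le_nhds)
          have h10 : c < 0 := by
            refine lt_of_le_of_ne (not_lt.1 fun hpos => hexc ⟨hx, hx', ?_⟩) (by exact_mod_cast hc0)
            rwa [h9, Complex.ofReal_re]
          rw [h8, signJump_odd_pos (by decide) (by linarith)]
          omega
        · by_cases h9 : ordQ (deriv f) x = 1
          · rw [h9, signJump_even (by decide)]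
            omega
          · omega
  by_cases hx' : deriv f x = 0
  · obtain ⟨c, hc, h1⟩ := leadsAt_ratioMulQ_of_critical hf h0' hx hx'
    refine ⟨_, c, h1, Or.inl ?_⟩
    have h2 := (leadsAt_of_critical hf h0' hx hx').2
    have h3 := analyticOrderNatAt_eq_zero_of hf hx
    have h5 := (leadsAt_Q_of_zero hf' h0' hx').ordQ_eq
    have h6 := analyticOrderNatAt_ne_zero_of hf' h0' hx'
    have h7 := neg_one_le_signJump (-3) c
    omega
  · obtain ⟨c, hc⟩ := leadsAt_of_regular hf hs hz₀ hQ hx hx'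
    have h3 := analyticOrderNatAt_eq_zero_of hf hx
    have h4 := analyticOrderNatAt_eq_zero_of hf' hx'
    have h5 := ordQ_nonneg hf hx
    have h5' := ordQ_nonneg hf' hx'
    by_cases h6 : ordQ f x = 0
    · obtain ⟨c₁, hc₁⟩ := leadsAt_ordQ_real hf' hs.deriv hz₀' hQ' x
      refine ⟨_, c * c₁, by simpa using! hc.mul hc₁, Or.inl ?_⟩
      by_cases h7 : ordQ (deriv f) x = 0
      · rw [h6, h7, signJump_even (by decide)]
        omega
      · have h8 := neg_one_le_signJump (ordQ f x + ordQ (deriv f) x) (c * c₁)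
        omega
    · have h7 := leadsAt_Q_deriv_of_zero_of_derivRatio hf hx hx' h6 hc
      have h8 := h7.ordQ_eq
      have hc0 : c ≠ 0 := by exact_mod_cast hc.1
      have h9 : LeadsAt (ratioMulQ f) x (ordQ f x + (ordQ f x - 1))
          ((c * (ordQ f x * c) : ℝ) : ℂ) := by
        simpa using! hc.mul h7
      refine ⟨_, _, h9, Or.inl ?_⟩
      -- At a zero of D of order k the product D Q₁ behaves like kc²(z - x)^(2k-1). The jump is
      -- always +1 and equals k - (k - 1).
      have h10 : Odd (ordQ f x + (ordQ f x - 1)) := ⟨ordQ f x - 1, by ring⟩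
      have h11 : (0 : ℝ) < ordQ f x := by exact_mod_cast lt_of_le_of_ne h5 (Ne.symm h6)
      rw [signJump_odd_pos h10 (by
        have := mul_pos h11 (mul_self_pos.2 hc0)
        linarith [(by ring : c * (ordQ f x * c) = ordQ f x * (c * c))])]
      omega

end Local

/-! ### Telescoping on an interval and signs on the real line -/

theorem finite_inter_of_eventually {X : Type*} [TopologicalSpace X] {K B : Set X} (hK : IsCompact K)
    (h : ∀ x, ∀ᶠ y in 𝓝[≠] x, y ∉ B) : (K ∩ B).Finite := by
  by_contra hinf
  obtain ⟨x, -, hx⟩ := Set.Infinite.exists_accPt_of_subset_isCompact (s := K ∩ B) hinf hK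
    Set.inter_subset_left
  rw [accPt_iff_frequently_nhdsNE] at hx
  exact hx ((h x).mono fun y hy hy' => hy hy'.2)

/-- Telescoping of the sign jumps of a function with leading terms. -/
theorem sum_signJump {G : ℂ → ℂ} (S : Finset ℝ) {a b : ℝ} (hab : a ≤ b) {d : ℝ → ℤ} {c : ℝ → ℝ}
    (hS : ∀ x ∈ S, x ∈ Set.Ioo a b) (hG : ∀ x ∈ S, LeadsAt G x (d x) (c x))
    (hoff : ∀ x ∈ Set.Icc a b, x ∉ S → ContinuousAt G x ∧ (G x).re ≠ 0) :
    ∑ x ∈ S, signJump (d x) (c x) = posInd G b - posInd G a := by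
  refine sum_jumps (posInd G) (fun x => signJump (d x) (c x)) S hab hS ?_
    fun x hx => (hG x hx).posInd_jump
  intro x hx hxS
  obtain ⟨hc, hne⟩ := hoff x hx hxS
  have h1 : ContinuousAt (fun y : ℝ => (G y).re) x :=
    Complex.continuous_re.continuousAt.comp (ContinuousAt.comp (g := G) (f := fun y : ℝ => (y : ℂ))
      hc Complex.continuous_ofReal.continuousAt)
  rcases lt_or_gt_of_ne hne with h | h
  · filter_upwards [h1.eventually_lt_const h] with y hy
    simp [posInd, hy.not_gt, h.not_gt]
  · filter_upwards [h1.eventually_const_lt h] with y hy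
    simp [posInd, hy, h]

theorem mul_pos_of_continuousOn_ne_zero {g : ℝ → ℝ} {a b x y : ℝ}
    (hg : ContinuousOn g (Set.Icc a b)) (hne : ∀ x ∈ Set.Icc a b, g x ≠ 0)
    (hx : x ∈ Set.Icc a b) (hy : y ∈ Set.Icc a b) : 0 < g x * g y := by
  by_contra hcon
  have hsub : Set.uIcc x y ⊆ Set.Icc a b := (Set.ordConnected_Icc).uIcc_subset hx hy
  have h0 : (0 : ℝ) ∈ Set.uIcc (g x) (g y) := by
    rw [Set.mem_uIcc]
    rcases mul_nonpos_iff.1 (not_lt.1 hcon) with h | h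
    · exact Or.inr ⟨h.2, h.1⟩
    · exact Or.inl h
  obtain ⟨w, hw, hw0⟩ := intermediate_value_uIcc (hg.mono hsub) h0
  exact hne w (hsub hw) hw0

section RealLine

variable {f : ℂ → ℂ}

theorem ConjSymm.eq_ofReal_re (hs : ConjSymm f) (x : ℝ) : f x = ((f x).re : ℂ) :=
  Complex.ext (by simp) (by simpa using hs.im_eq_zero x)

theorem ConjSymm.re_ne_zero (hs : ConjSymm f) {x : ℝ} (h : f x ≠ 0) : (f x).re ≠ 0 := fun h0 =>
  h (Complex.ext h0 (hs.im_eq_zero x))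

theorem hasDerivAt_re (hf : Differentiable ℂ f) (x : ℝ) :
    HasDerivAt (fun y : ℝ => (f y).re) (deriv f x).re x :=
  (hf x).hasDerivAt.real_of_complex

theorem continuous_re_ofReal (hf : Differentiable ℂ f) : Continuous fun y : ℝ => (f y).re :=
  Complex.continuous_re.comp (hf.continuous.comp Complex.continuous_ofReal)

theorem exists_deriv_eq_zero_between (hf : Differentiable ℂ f) (hs : ConjSymm f) {a b : ℝ}
    (hab : a < b) (ha : f a = 0) (hb : f b = 0) : ∃ c ∈ Set.Ioo a b, deriv f c = 0 := by
  obtain ⟨c, hc, h⟩ := exists_hasDerivAt_eq_zero hab (continuous_re_ofReal hf).continuousOn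
    (by rw [ha, hb]) fun x _ => hasDerivAt_re hf x
  exact ⟨c, hc, Complex.ext h (hs.deriv.im_eq_zero c)⟩

/-- By the mean value theorem f(b) = (b - a)f'(c), and f' keeps its sign on [a, b]. So L > 0 to the
right of a zero until the next critical point. -/
theorem re_mul_deriv_pos_right (hf : Differentiable ℂ f) (hs : ConjSymm f) {a b : ℝ} (hab : a < b)
    (ha : f a = 0) (hne : ∀ x ∈ Set.Icc a b, deriv f (x : ℝ) ≠ 0) :
    0 < (deriv f b).re * (f b).re := by
  obtain ⟨c, hc, h⟩ := exists_hasDerivAt_eq_slope (fun y : ℝ => (f y).re) _ hab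
    (continuous_re_ofReal hf).continuousOn fun x _ => hasDerivAt_re hf x
  have h1 := mul_pos_of_continuousOn_ne_zero
    (continuous_re_ofReal (deriv_entire hf)).continuousOn
    (fun x hx => hs.deriv.re_ne_zero (hne x hx)) (Set.right_mem_Icc.2 hab.le)
    (Set.Ioo_subset_Icc_self hc)
  have h2 : 0 < b - a := sub_pos.2 hab
  rw [h, ha, Complex.zero_re, sub_zero, ← mul_div_assoc] at h1
  exact (div_pos_iff_of_pos_right h2).1 h1

theorem re_mul_deriv_neg_left (hf : Differentiable ℂ f) (hs : ConjSymm f) {a b : ℝ} (hab : a < b)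
    (hb : f b = 0) (hne : ∀ x ∈ Set.Icc a b, deriv f (x : ℝ) ≠ 0) :
    (deriv f a).re * (f a).re < 0 := by
  obtain ⟨c, hc, h⟩ := exists_hasDerivAt_eq_slope (fun y : ℝ => (f y).re) _ hab
    (continuous_re_ofReal hf).continuousOn fun x _ => hasDerivAt_re hf x
  have h1 := mul_pos_of_continuousOn_ne_zero
    (continuous_re_ofReal (deriv_entire hf)).continuousOn
    (fun x hx => hs.deriv.re_ne_zero (hne x hx)) (Set.left_mem_Icc.2 hab.le)
    (Set.Ioo_subset_Icc_self hc)
  have h2 : 0 < b - a := sub_pos.2 hab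
  rw [h, hb, Complex.zero_re, zero_sub, ← mul_div_assoc] at h1
  have := (div_pos_iff_of_pos_right h2).1 h1
  linarith

theorem logDeriv_re (hs : ConjSymm f) (x : ℝ) :
    (deriv f x / f x).re = (deriv f x).re / (f x).re := by
  rw [hs.deriv.eq_ofReal_re, hs.eq_ofReal_re, ← Complex.ofReal_div]
  simp

theorem derivRatio_re (hs : ConjSymm f) (x : ℝ) :
    (derivRatio f x).re = (logDerivDeriv f x).re / (deriv f x / f x).re := by
  rw [derivRatio, (logDerivDeriv_conjSymm hs).eq_ofReal_re, (hs.deriv.div hs).eq_ofReal_re,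
    ← Complex.ofReal_div]
  simp

theorem ratioMulQ_re (hs : ConjSymm f) (x : ℝ) :
    (ratioMulQ f x).re = (derivRatio f x).re * (logDerivDeriv (deriv f) x).re := by
  rw [ratioMulQ, (derivRatio_conjSymm hs).eq_ofReal_re, Complex.re_ofReal_mul, Complex.ofReal_re]

theorem posInd_derivRatio (hs : ConjSymm f) {x : ℝ} (hx : f x ≠ 0) (hx' : deriv f x ≠ 0)
    (hQ : (logDerivDeriv f x).re < 0) :
    posInd (derivRatio f) x = 1 - posInd (fun z => deriv f z / f z) x := by
  have hne : (deriv f x / f x).re ≠ 0 := (hs.deriv.div hs).re_ne_zero (div_ne_zero hx' hx)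
  unfold posInd
  rw [derivRatio_re hs]
  rcases lt_or_gt_of_ne hne with h | h
  · simp [div_pos_of_neg_of_neg hQ h, h.not_gt]
  · simp [(div_neg_of_neg_of_pos hQ h).not_gt, h]

/-- D Q₁ = Q Q₁/L, and the two negative signs of Q and Q₁ cancel. This evaluates the boundary terms
at ±R. -/
theorem posInd_ratioMulQ (hs : ConjSymm f) {x : ℝ} (hx : f x ≠ 0) (hx' : deriv f x ≠ 0)
    (hQ : (logDerivDeriv f x).re < 0) (hQ' : (logDerivDeriv (deriv f) x).re < 0) :
    posInd (ratioMulQ f) x = posInd (fun z => deriv f z / f z) x := by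
  have hne : (deriv f x / f x).re ≠ 0 := (hs.deriv.div hs).re_ne_zero (div_ne_zero hx' hx)
  unfold posInd
  rw [ratioMulQ_re hs, derivRatio_re hs]
  rcases lt_or_gt_of_ne hne with h | h
  · have := mul_neg_of_pos_of_neg (div_pos_of_neg_of_neg hQ h) hQ'
    simp [this.not_gt, h.not_gt]
  · have := mul_pos_of_neg_of_neg (div_neg_of_neg_of_pos hQ h) hQ'
    simp [this, h]

theorem continuousAt_derivRatio (hf : Differentiable ℂ f) {z : ℂ} (hz : f z ≠ 0)
    (hz' : deriv f z ≠ 0) : ContinuousAt (derivRatio f) z :=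
  ((logDerivDeriv_analyticAt hf hz).div (logDeriv_analyticAt hf hz)
    (div_ne_zero hz' hz)).continuousAt

theorem continuousAt_ratioMulQ (hf : Differentiable ℂ f) {z : ℂ} (hz : f z ≠ 0)
    (hz' : deriv f z ≠ 0) : ContinuousAt (ratioMulQ f) z :=
  (continuousAt_derivRatio hf hz hz').mul
    (logDerivDeriv_analyticAt (deriv_entire hf) hz').continuousAt

theorem derivRatio_re_ne_zero (hs : ConjSymm f) {x : ℝ} (hx : f x ≠ 0) (hx' : deriv f x ≠ 0)
    (hQ : logDerivDeriv f x ≠ 0) : (derivRatio f x).re ≠ 0 :=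
  (derivRatio_conjSymm hs).re_ne_zero (div_ne_zero hQ (div_ne_zero hx' hx))

theorem ratioMulQ_re_ne_zero (hs : ConjSymm f) {x : ℝ} (hx : f x ≠ 0) (hx' : deriv f x ≠ 0)
    (hQ : logDerivDeriv f x ≠ 0) (hQ' : logDerivDeriv (deriv f) x ≠ 0) :
    (ratioMulQ f x).re ≠ 0 := by
  rw [ratioMulQ_re hs]
  exact mul_ne_zero (derivRatio_re_ne_zero hs hx hx' hQ)
    ((logDerivDeriv_conjSymm hs.deriv).re_ne_zero hQ')

/-- A sign change from negative to positive comes from a positive jump. -/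
theorem exists_signJump_pos {G : ℂ → ℂ} {S : Finset ℝ} {u v : ℝ} (huv : u < v) {e : ℝ → ℤ}
    {c : ℝ → ℝ} (hu : posInd G u = 0) (hv : posInd G v = 1) (huS : u ∉ S) (hvS : v ∉ S)
    (hG : ∀ x ∈ S, LeadsAt G x (e x) (c x))
    (hoff : ∀ x ∈ Set.Icc u v, x ∉ S → ContinuousAt G x ∧ (G x).re ≠ 0) :
    ∃ ξ ∈ S, ξ ∈ Set.Ioo u v ∧ 0 < signJump (e ξ) (c ξ) := by
  classical
  have h := sum_signJump (G := G) (S.filter (· ∈ Set.Ioo u v)) huv.le (d := e) (c := c)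
    (fun x hx => (Finset.mem_filter.1 hx).2) (fun x hx => hG x (Finset.mem_filter.1 hx).1)
    (fun x hx hxS => hoff x hx fun hxS' => by
      refine hxS (Finset.mem_filter.2 ⟨hxS', ?_, ?_⟩)
      · exact lt_of_le_of_ne hx.1 (by rintro rfl; exact huS hxS')
      · exact lt_of_le_of_ne hx.2 (by rintro rfl; exact hvS hxS'))
  rw [hu, hv] at h
  obtain ⟨ξ, hξ, hpos⟩ := Finset.exists_lt_of_sum_lt (s := S.filter (· ∈ Set.Ioo u v))
    (f := fun _ => (0 : ℤ)) (g := fun x => signJump (e x) (c x)) (by rw [h]; simp)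
  exact ⟨ξ, (Finset.mem_filter.1 hξ).1, (Finset.mem_filter.1 hξ).2, hpos⟩

/-- Where f, f' and Q do not vanish, D has order 0, so a positive jump of D Q₁ can only come from an
odd zero of Q₁. The left side before adding 2 is then at most -1 while the jump is +1. -/
theorem two_le_slack (hf : Differentiable ℂ f) (hs : ConjSymm f) {z₀ : ℂ} (hz₀ : f z₀ ≠ 0)
    (hQ : logDerivDeriv f z₀ ≠ 0) (hz₀' : deriv f z₀ ≠ 0) (hQ' : logDerivDeriv (deriv f) z₀ ≠ 0)
    {x : ℝ} (hx : f x ≠ 0) (hx' : deriv f x ≠ 0) (hmult : zeroMultiplicity (logDerivDeriv f) x = 0)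
    {e : ℤ} {c : ℝ} (h : LeadsAt (ratioMulQ f) x e c) (hpos : 0 < signJump e c) :
    ((ordQ f x).toNat : ℤ) - (ordQ (deriv f) x).toNat -
      ((analyticOrderNatAt (deriv f) x : ℤ) - analyticOrderNatAt f x) + 2 ≤ signJump e c := by
  have hf' := deriv_entire hf
  obtain ⟨d, hd⟩ := leadsAt_ordQ hf hz₀ hQ x
  have h1 : (ordQ f x).toNat = 0 := by
    rw [zeroMultiplicity, hd.order] at hmult
    have h2 : (((ordQ f x).toNat : ℕ) : ℕ∞) = 0 := hmult
    exact_mod_cast h2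
  have h2 := ordQ_nonneg hf hx
  have h3 := ordQ_nonneg hf' hx'
  obtain ⟨c₁, hc₁⟩ := leadsAt_of_regular hf hs hz₀ hQ hx hx'
  obtain ⟨c₂, hc₂⟩ := leadsAt_ordQ_real hf' hs.deriv hz₀' hQ' x
  have h4 : e = ordQ f x + ordQ (deriv f) x := h.order_unique (hc₁.mul hc₂)
  have h5 : ¬ Even e := fun he => by rw [signJump_even he] at hpos; exact lt_irrefl _ hpos
  have h6 : ordQ (deriv f) x ≠ 0 := fun h7 => h5 (by
    rw [h4, h7]; have : ordQ f x = 0 := by omega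
    rw [this]; decide)
  rw [analyticOrderNatAt_eq_zero_of hf hx, analyticOrderNatAt_eq_zero_of hf' hx']
  omega

theorem eventually_ne_zero_real {g : ℂ → ℂ} (hg : Differentiable ℂ g) (h0 : g ≠ 0) (x : ℝ) :
    ∀ᶠ y : ℝ in 𝓝[≠] x, g y ≠ 0 := by
  obtain ⟨c, hc⟩ := leadsAt_analyticOrderNatAt hg h0 x
  exact (tendsto_ofReal_nhdsNE x).eventually hc.eventually_ne_zero

/-- Supplies the endpoint to which property A is applied; zeros of g cannot accumulate, so a nearest
one exists unless there is none. -/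
theorem exists_nearest_zero_right {g : ℂ → ℂ} (hg : Differentiable ℂ g) (h0 : g ≠ 0) (a : ℝ) :
    ∃ β : EReal, (a : EReal) < β ∧ (β = ⊤ ∨ ∃ b : ℝ, β = (b : EReal) ∧ g (b : ℂ) = 0) ∧
      ∀ x : ℝ, a < x → (x : EReal) < β → g (x : ℂ) ≠ 0 := by
  by_cases h : ∃ b : ℝ, a < b ∧ g b = 0
  · obtain ⟨b₀, hb₀, hgb₀⟩ := h
    have hfin : (Set.Icc a b₀ ∩ {y : ℝ | a < y ∧ g y = 0}).Finite :=
      finite_inter_of_eventually isCompact_Icc fun x =>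
        (eventually_ne_zero_real hg h0 x).mono fun y hy hy' => hy hy'.2
    obtain ⟨b, ⟨hb, hab, hgb⟩, hmin⟩ := hfin.exists_minimal ⟨b₀, ⟨hb₀.le, le_rfl⟩, hb₀, hgb₀⟩
    refine ⟨b, by exact_mod_cast hab, Or.inr ⟨b, rfl, hgb⟩, fun x hx hxb hgx => ?_⟩
    have hxb' : x < b := by exact_mod_cast hxb
    exact absurd (hmin (y := x) ⟨⟨hx.le, hxb'.le.trans hb.2⟩, hx, hgx⟩ hxb'.le) (not_le.2 hxb')
  · push Not at h
    exact ⟨⊤, EReal.coe_lt_top a, Or.inl rfl, fun x hx _ => h x hx⟩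

theorem exists_nearest_zero_left {g : ℂ → ℂ} (hg : Differentiable ℂ g) (h0 : g ≠ 0) (a : ℝ) :
    ∃ β : EReal, β < (a : EReal) ∧ (β = ⊥ ∨ ∃ b : ℝ, β = (b : EReal) ∧ g (b : ℂ) = 0) ∧
      ∀ x : ℝ, x < a → β < (x : EReal) → g (x : ℂ) ≠ 0 := by
  by_cases h : ∃ b : ℝ, b < a ∧ g b = 0
  · obtain ⟨b₀, hb₀, hgb₀⟩ := h
    have hfin : (Set.Icc b₀ a ∩ {y : ℝ | y < a ∧ g y = 0}).Finite :=
      finite_inter_of_eventually isCompact_Icc fun x =>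
        (eventually_ne_zero_real hg h0 x).mono fun y hy hy' => hy hy'.2
    obtain ⟨b, ⟨hb, hab, hgb⟩, hmax⟩ := hfin.exists_maximal ⟨b₀, ⟨le_rfl, hb₀.le⟩, hb₀, hgb₀⟩
    refine ⟨b, by exact_mod_cast hab, Or.inr ⟨b, rfl, hgb⟩, fun x hx hxb hgx => ?_⟩
    have hxb' : b < x := by exact_mod_cast hxb
    exact absurd (hmax (y := x) ⟨⟨hb.1.trans hxb'.le, hx.le⟩, hx, hgx⟩ hxb'.le) (not_le.2 hxb')
  · push Not at h
    exact ⟨⊥, EReal.bot_lt_coe a, Or.inl rfl, fun x hx _ => h x hx⟩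

/-! ### Compensation of exceptional zeros and the two global inequalities -/

/-- Property A provides, next to each exceptional zero, a point that compensates for it. -/
theorem IsExceptional.exists_compensation (hf : Differentiable ℂ f) (hs : ConjSymm f) {R : ℝ}
    (hR : ∀ y : ℝ, y = R ∨ y = -R → f y ≠ 0 ∧ deriv f y ≠ 0 ∧ (logDerivDeriv f y).re < 0 ∧
      (logDerivDeriv (deriv f) y).re < 0)
    {S : Finset ℝ} (hS : ∀ x ∈ S, x ∈ Set.Ioo (-R) R)
    (hoff : ∀ x ∈ Set.Icc (-R) R, x ∉ S → ContinuousAt (ratioMulQ f) x ∧ (ratioMulQ f x).re ≠ 0)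
    {e : ℝ → ℤ} {c : ℝ → ℝ} (hG : ∀ x : ℝ, LeadsAt (ratioMulQ f) x (e x) (c x)) {α : ℝ}
    (hα : α ∈ Set.Ioo (-R) R) (hexc : IsExceptional f α) (hA : HasPropertyAAt f α) :
    ∃ ξ ∈ S, (∀ x ∈ Set.uIcc α ξ, deriv f (x : ℝ) ≠ 0) ∧
      ((ordQ f ξ).toNat : ℤ) - (ordQ (deriv f) ξ).toNat -
        ((analyticOrderNatAt (deriv f) ξ : ℤ) - analyticOrderNatAt f ξ) + 2 ≤
          signJump (e ξ) (c ξ) := by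
  have hRR := hR R (Or.inl rfl)
  have hRL := hR (-R) (Or.inr rfl)
  have hQ : logDerivDeriv f R ≠ 0 := fun h => by have := hRR.2.2.1; rw [h] at this; simp at this
  have hQ' : logDerivDeriv (deriv f) R ≠ 0 := fun h => by
    have := hRR.2.2.2; rw [h] at this; simp at this
  have hf' := deriv_entire hf
  have h0 : f ≠ 0 := fun h => hRR.1 (by rw [h]; rfl)
  have h0' : deriv f ≠ 0 := fun h => hRR.2.1 (by rw [h]; rfl)
  obtain ⟨a, ha, hLa⟩ := hexc.leadsAt hf hs h0 h0'
  obtain ⟨β₁, hβ₁, hβ₁', hne₁⟩ := exists_nearest_zero_left hf' h0' α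
  obtain ⟨β₂, hβ₂, hβ₂', hne₂⟩ := exists_nearest_zero_right hf' h0' α
  -- A critical point that is not a zero of f has D Q₁ positive just to its left and negative just
  -- to its right; the exceptional zero itself shows the same pattern. So on either side of α the
  -- sign must change upwards at a point strictly between.
  have hcrit : ∀ b : ℝ, f b ≠ 0 → deriv f b = 0 →
      (∀ᶠ y in 𝓝[<] b, posInd (ratioMulQ f) y = 1) ∧ ∀ᶠ y in 𝓝[>] b, posInd (ratioMulQ f) y = 0 := by
    intro b hb hb'
    obtain ⟨k, hk, hL⟩ := leadsAt_ratioMulQ_of_critical hf h0' hb hb'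
    constructor
    · filter_upwards [hL.sign_left] with y hy
      have h2 : (0 : ℝ) < (-1) ^ (-3 : ℤ) * k := by norm_num; exact hk
      exact if_pos ((pos_iff_pos_of_mul_pos hy).1 h2)
    · filter_upwards [hL.sign_right] with y hy
      exact if_neg fun h2 => absurd ((pos_iff_pos_of_mul_pos hy).2 h2) hk.not_gt
  have hmid : ∀ x : ℝ, β₁ < (x : EReal) → (x : EReal) < β₂ → deriv f (x : ℂ) ≠ 0 := by
    intro x h1 h2
    rcases lt_trichotomy x α with h | h | h
    · exact hne₁ x h h1
    · rw [h]; exact hexc.2.1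
    · exact hne₂ x h h2
  rcases hA β₁ β₂ hβ₁ hβ₂ hβ₁' hβ₂' (fun x h1 h2 _ => hmid x h1 h2) with hno | hno
  · have hu : ∃ u : ℝ, u < α ∧ -R ≤ u ∧ β₁ < (u : EReal) ∧ posInd (ratioMulQ f) u = 0 ∧ u ∉ S := by
      -- If no critical point lies in [-R, α), start at -R. There D Q₁ has the sign of L, and L < 0
      -- because f moves monotonically towards its zero α.
      have hend : β₁ < ((-R : ℝ) : EReal) → ∃ u : ℝ, u < α ∧ -R ≤ u ∧ β₁ < (u : EReal) ∧
          posInd (ratioMulQ f) u = 0 ∧ u ∉ S := by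
        intro hlt
        refine ⟨-R, hα.1, le_rfl, hlt, ?_, fun h => lt_irrefl _ (hS _ h).1⟩
        rw [posInd_ratioMulQ hs hRL.1 hRL.2.1 hRL.2.2.1 hRL.2.2.2]
        have h3 := re_mul_deriv_neg_left hf hs hα.1 hexc.1 fun x hx =>
          hmid x (hlt.trans_le (by exact_mod_cast hx.1))
            (lt_of_le_of_lt (by exact_mod_cast hx.2) hβ₂)
        refine if_neg ?_
        rw [logDeriv_re hs]
        exact fun h4 => h3.not_ge (mul_nonneg_iff.2 (by
          rcases div_pos_iff.1 h4 with h5 | h5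
          · exact Or.inl ⟨h5.1.le, h5.2.le⟩
          · exact Or.inr ⟨h5.1.le, h5.2.le⟩))
      rcases hβ₁' with h | ⟨b, rfl, hb⟩
      · exact hend (by rw [h]; exact EReal.bot_lt_coe _)
      · have hbα : b < α := by exact_mod_cast hβ₁
        rcases lt_trichotomy b (-R) with h | h | h
        · exact hend (by exact_mod_cast h)
        · exact absurd hb (h ▸ hRL.2.1)
        -- A zero of f at b would by Rolle produce a critical point between b and α, against the
        -- choice of b as nearest.
        · have hfb : f b ≠ 0 := fun hfb => by
            obtain ⟨k, hk, hk'⟩ := exists_deriv_eq_zero_between hf hs hbα hfb hexc.1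
            exact hne₁ k hk.2 (by exact_mod_cast hk.1) hk'
          obtain ⟨u, h1, h2, h3, h4⟩ := ((hcrit b hfb hb).2.and (((eventually_notMem_finset S b).filter_mono
            (nhdsWithin_mono b fun y (hy : b < y) => hy.ne')).and
            (((gt_mem_nhds hbα).filter_mono nhdsWithin_le_nhds).and self_mem_nhdsWithin))).exists
          exact ⟨u, h3, (h.trans h4).le, by exact_mod_cast h4, h1, h2⟩
    obtain ⟨u, huα, hRu, hβu, hu0, huS⟩ := hu
    have hv : ∀ᶠ y in 𝓝[<] α, posInd (ratioMulQ f) y = 1 := by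
      filter_upwards [hLa.sign_left] with y hy
      have h2 : (0 : ℝ) < (-1) ^ (-1 : ℤ) * a := by norm_num; exact ha
      exact if_pos ((pos_iff_pos_of_mul_pos hy).1 h2)
    obtain ⟨v, h1, h2, h3, h4⟩ := (hv.and (((eventually_notMem_finset S α).filter_mono
      (nhdsWithin_mono α fun y (hy : y < α) => hy.ne)).and
      (((lt_mem_nhds huα).filter_mono nhdsWithin_le_nhds).and self_mem_nhdsWithin))).exists
    obtain ⟨ξ, hξS, hξ, hpos⟩ := exists_signJump_pos (G := ratioMulQ f) h3 (e := e) (c := c) hu0 h1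
      huS h2 (fun x _ => hG x) fun x hx =>
        hoff x ⟨hRu.trans hx.1, (hx.2.trans (le_of_lt h4)).trans hα.2.le⟩
    have hξα : ξ < α := hξ.2.trans h4
    have hβξ : β₁ < (ξ : EReal) := hβu.trans (by exact_mod_cast hξ.1)
    have hcl : ∀ x ∈ Set.uIcc α ξ, deriv f (x : ℝ) ≠ 0 := by
      intro x hx
      rw [Set.uIcc_of_ge hξα.le] at hx
      exact hmid x (hβξ.trans_le (by exact_mod_cast hx.1))
        (lt_of_le_of_lt (by exact_mod_cast hx.2) hβ₂)
    refine ⟨ξ, hξS, hcl, two_le_slack hf hs hRR.1 hQ hRR.2.1 hQ' (fun hfξ => ?_)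
      (hcl ξ Set.right_mem_uIcc) (hno ξ hβξ (by exact_mod_cast hξα)) (hG ξ) hpos⟩
    obtain ⟨k, hk, hk'⟩ := exists_deriv_eq_zero_between hf hs hξα hfξ hexc.1
    exact hcl k (by rw [Set.uIcc_of_ge hξα.le]; exact ⟨hk.1.le, hk.2.le⟩) hk'
  · have hv : ∃ v : ℝ, α < v ∧ v ≤ R ∧ (v : EReal) < β₂ ∧ posInd (ratioMulQ f) v = 1 ∧ v ∉ S := by
      -- The mirror image: if no critical point lies in (α, R], stop at R, where L > 0 and hence D
      -- Q₁ > 0.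
      have hend : ((R : ℝ) : EReal) < β₂ → ∃ v : ℝ, α < v ∧ v ≤ R ∧ (v : EReal) < β₂ ∧
          posInd (ratioMulQ f) v = 1 ∧ v ∉ S := by
        intro hlt
        refine ⟨R, hα.2, le_rfl, hlt, ?_, fun h => lt_irrefl _ (hS _ h).2⟩
        rw [posInd_ratioMulQ hs hRR.1 hRR.2.1 hRR.2.2.1 hRR.2.2.2]
        have h3 := re_mul_deriv_pos_right hf hs hα.2 hexc.1 fun x hx =>
          hmid x (hβ₁.trans_le (by exact_mod_cast hx.1))
            (lt_of_le_of_lt (by exact_mod_cast hx.2) hlt)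
        refine if_pos ?_
        rw [logDeriv_re hs]
        exact div_pos_iff.2 (mul_pos_iff.1 h3)
      rcases hβ₂' with h | ⟨b, rfl, hb⟩
      · exact hend (by rw [h]; exact EReal.coe_lt_top _)
      · have hbα : α < b := by exact_mod_cast hβ₂
        rcases lt_trichotomy R b with h | h | h
        · exact hend (by exact_mod_cast h)
        · exact absurd hb (h ▸ hRR.2.1)
        · have hfb : f b ≠ 0 := fun hfb => by
            obtain ⟨k, hk, hk'⟩ := exists_deriv_eq_zero_between hf hs hbα hexc.1 hfb
            exact hne₂ k hk.1 (by exact_mod_cast hk.2) hk'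
          obtain ⟨u, h1, h2, h3, h4⟩ := ((hcrit b hfb hb).1.and (((eventually_notMem_finset S b).filter_mono
            (nhdsWithin_mono b fun y (hy : y < b) => hy.ne)).and
            (((lt_mem_nhds hbα).filter_mono nhdsWithin_le_nhds).and self_mem_nhdsWithin))).exists
          exact ⟨u, h3, (lt_trans h4 h).le, by exact_mod_cast h4, h1, h2⟩
    obtain ⟨v, hαv, hvR, hvβ, hv1, hvS⟩ := hv
    have hu : ∀ᶠ y in 𝓝[>] α, posInd (ratioMulQ f) y = 0 := by
      filter_upwards [hLa.sign_right] with y hy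
      exact if_neg fun h2 => absurd ((pos_iff_pos_of_mul_pos hy).2 h2) ha.not_gt
    obtain ⟨u, h1, h2, h3, h4⟩ := (hu.and (((eventually_notMem_finset S α).filter_mono
      (nhdsWithin_mono α fun y (hy : α < y) => hy.ne')).and
      (((gt_mem_nhds hαv).filter_mono nhdsWithin_le_nhds).and self_mem_nhdsWithin))).exists
    obtain ⟨ξ, hξS, hξ, hpos⟩ := exists_signJump_pos (G := ratioMulQ f) h3 (e := e) (c := c) h1 hv1
      h2 hvS (fun x _ => hG x) fun x hx =>
        hoff x ⟨(hα.1.trans h4).le.trans hx.1, hx.2.trans hvR⟩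
    have hξα : α < ξ := lt_trans h4 hξ.1
    have hξβ : (ξ : EReal) < β₂ := lt_trans (by exact_mod_cast hξ.2) hvβ
    have hcl : ∀ x ∈ Set.uIcc α ξ, deriv f (x : ℝ) ≠ 0 := by
      intro x hx
      rw [Set.uIcc_of_le hξα.le] at hx
      exact hmid x (hβ₁.trans_le (by exact_mod_cast hx.1))
        (lt_of_le_of_lt (by exact_mod_cast hx.2) hξβ)
    refine ⟨ξ, hξS, hcl, two_le_slack hf hs hRR.1 hQ hRR.2.1 hQ' (fun hfξ => ?_)
      (hcl ξ Set.right_mem_uIcc) (hno ξ (by exact_mod_cast hξα) hξβ) (hG ξ) hpos⟩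
    obtain ⟨k, hk, hk'⟩ := exists_deriv_eq_zero_between hf hs hξα hexc.1 hfξ
    exact hcl k (by rw [Set.uIcc_of_le hξα.le]; exact ⟨hk.1.le, hk.2.le⟩) hk'

/-- The upper bound in terms of sums over a finite set of real points. -/
theorem sum_ordQ_sub_le (hf : Differentiable ℂ f) (hs : ConjSymm f) {R : ℝ} (hR0 : 0 < R)
    (hR : ∀ y : ℝ, y = R ∨ y = -R → f y ≠ 0 ∧ deriv f y ≠ 0 ∧ (logDerivDeriv f y).re < 0 ∧
      (logDerivDeriv (deriv f) y).re < 0)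
    {S : Finset ℝ} (hS : ∀ x ∈ S, x ∈ Set.Ioo (-R) R)
    (hoff : ∀ x ∈ Set.Icc (-R) R, x ∉ S → f (x : ℝ) ≠ 0 ∧ deriv f x ≠ 0 ∧ logDerivDeriv f x ≠ 0 ∧
      logDerivDeriv (deriv f) x ≠ 0) (hA : HasPropertyA f) :
    ∑ x ∈ S, (((ordQ f x).toNat : ℤ) - (ordQ (deriv f) x).toNat -
        ((analyticOrderNatAt (deriv f) x : ℤ) - analyticOrderNatAt f x)) ≤
      posInd (fun z => deriv f z / f z) R - posInd (fun z => deriv f z / f z) (-R) := by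
  classical
  have hRR := hR R (Or.inl rfl)
  have hRL := hR (-R) (Or.inr rfl)
  have hQ : logDerivDeriv f R ≠ 0 := fun h => by have := hRR.2.2.1; rw [h] at this; simp at this
  have hQ' : logDerivDeriv (deriv f) R ≠ 0 := fun h => by
    have := hRR.2.2.2; rw [h] at this; simp at this
  choose e c hG hloc using fun x : ℝ => ratioMulQ_local hf hs hRR.1 hQ hRR.2.1 hQ' x
  have hoff' : ∀ x ∈ Set.Icc (-R) R, x ∉ S →
      ContinuousAt (ratioMulQ f) x ∧ (ratioMulQ f x).re ≠ 0 := fun x hx hxS => by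
    obtain ⟨h1, h2, h3, h4⟩ := hoff x hx hxS
    exact ⟨continuousAt_ratioMulQ hf h1 h2, ratioMulQ_re_ne_zero hs h1 h2 h3 h4⟩
  have hsum := sum_signJump (G := ratioMulQ f) S (by linarith : -R ≤ R) (d := e) (c := c) hS
    (fun x _ => hG x) hoff'
  rw [posInd_ratioMulQ hs hRR.1 hRR.2.1 hRR.2.2.1 hRR.2.2.2,
    posInd_ratioMulQ hs hRL.1 hRL.2.1 hRL.2.2.1 hRL.2.2.2] at hsum
  rw [← hsum, ← sub_nonneg, ← Finset.sum_sub_distrib]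
  set w : ℝ → ℤ := fun x => ((ordQ f x).toNat : ℤ) - (ordQ (deriv f) x).toNat -
        ((analyticOrderNatAt (deriv f) x : ℤ) - analyticOrderNatAt f x) with hw
  have hcomp : ∀ α ∈ S.filter (IsExceptional f), ∃ ξ ∈ S,
      (∀ x ∈ Set.uIcc α ξ, deriv f (x : ℝ) ≠ 0) ∧ w ξ + 2 ≤ signJump (e ξ) (c ξ) := by
    intro α hα
    obtain ⟨hαS, hexc⟩ := Finset.mem_filter.1 hα
    exact hexc.exists_compensation hf hs hR hS hoff' hG (hS α hαS) (hA α hexc.1)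
  choose! ξ hξS hξne hξ using hcomp
  -- Two exceptional zeros have a critical point k between them, and a common compensator would put
  -- k between it and one of the zeros, where f' does not vanish.
  have hnolt : ∀ α ∈ S.filter (IsExceptional f), ∀ α' ∈ S.filter (IsExceptional f), ξ α = ξ α' →
      ¬ α < α' := by
    intro α hα α' hα' heq hlt
    obtain ⟨k, hk, hk'⟩ := exists_deriv_eq_zero_between hf hs hlt (Finset.mem_filter.1 hα).2.1
      (Finset.mem_filter.1 hα').2.1
    rcases le_total k (ξ α) with h | h
    · exact hξne α hα k (Set.mem_uIcc.2 (Or.inl ⟨hk.1.le, h⟩)) hk'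
    · exact hξne α' hα' k (Set.mem_uIcc.2 (Or.inr ⟨heq ▸ h, hk.2.le⟩)) hk'
  have hinj : Set.InjOn ξ (S.filter (IsExceptional f) : Set ℝ) := fun α hα α' hα' heq =>
    le_antisymm (not_lt.1 (hnolt α' hα' α hα heq.symm)) (not_lt.1 (hnolt α hα α' hα' heq))
  -- Slack is bounded below by +2 at compensators and -2 at exceptional zeros. Injectivity makes the
  -- two contributions cancel in the sum.
  have hpt : ∀ x ∈ S, (if x ∈ (S.filter (IsExceptional f)).image ξ then (2 : ℤ) else 0) -
      (if x ∈ S.filter (IsExceptional f) then 2 else 0) ≤ signJump (e x) (c x) - w x := by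
    intro x hx
    by_cases h1 : x ∈ (S.filter (IsExceptional f)).image ξ
    · obtain ⟨α, hα, rfl⟩ := Finset.mem_image.1 h1
      have h2 := hξ α hα
      rw [if_pos h1]
      split_ifs <;> linarith
    · rw [if_neg h1]
      by_cases h2 : IsExceptional f x
      · rw [if_pos (Finset.mem_filter.2 ⟨hx, h2⟩)]
        rcases hloc x with h3 | ⟨-, h3⟩ <;> simp only [hw] <;> linarith
      · rw [if_neg (fun h => h2 (Finset.mem_filter.1 h).2)]
        rcases hloc x with h3 | ⟨h3, -⟩
        · simp only [hw]; linarith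
        · exact absurd h3 h2
  refine le_trans (le_of_eq ?_) (Finset.sum_le_sum hpt)
  rw [Finset.sum_sub_distrib, Finset.sum_ite_mem, Finset.sum_ite_mem,
    Finset.inter_eq_right.2 (Finset.filter_subset _ _),
    Finset.inter_eq_right.2 (fun x hx => by
      obtain ⟨α, hα, rfl⟩ := Finset.mem_image.1 hx
      exact hξS α hα)]
  simp [Finset.card_image_of_injOn hinj]

/-- The lower bound in terms of sums over a finite set of real points. -/
theorem sum_order_sub_le (hf : Differentiable ℂ f) (hs : ConjSymm f) {R : ℝ} (hR0 : 0 < R)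
    (hR : ∀ y : ℝ, y = R ∨ y = -R → f y ≠ 0 ∧ deriv f y ≠ 0 ∧ (logDerivDeriv f y).re < 0)
    {S : Finset ℝ} (hS : ∀ x ∈ S, x ∈ Set.Ioo (-R) R)
    (hoff : ∀ x ∈ Set.Icc (-R) R, x ∉ S → f (x : ℝ) ≠ 0 ∧ deriv f x ≠ 0 ∧ logDerivDeriv f x ≠ 0) :
    ∑ x ∈ S, ((analyticOrderNatAt (deriv f) x : ℤ) - analyticOrderNatAt f x -
        (ordQ f x).toNat) ≤
      posInd (fun z => deriv f z / f z) (-R) - posInd (fun z => deriv f z / f z) R := by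
  have hRR := hR R (Or.inl rfl)
  have hRL := hR (-R) (Or.inr rfl)
  have hQ : logDerivDeriv f R ≠ 0 := fun h => by have := hRR.2.2; rw [h] at this; simp at this
  have h0' : deriv f ≠ 0 := fun h => hRR.2.1 (by rw [h]; rfl)
  choose d c hG hloc using fun x : ℝ => order_sub_le_jump hf hs h0' hRR.1 hQ x
  have hsum := sum_signJump (G := derivRatio f) S (by linarith : -R ≤ R) (d := d) (c := c) hS
    (fun x _ => hG x) fun x hx hxS => by
      obtain ⟨h1, h2, h3⟩ := hoff x hx hxS
      exact ⟨continuousAt_derivRatio hf h1 h2, derivRatio_re_ne_zero hs h1 h2 h3⟩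
  rw [posInd_derivRatio hs hRR.1 hRR.2.1 hRR.2.2,
    posInd_derivRatio hs hRL.1 hRL.2.1 hRL.2.2] at hsum
  have := Finset.sum_le_sum fun x (_ : x ∈ S) => hloc x
  linarith

end RealLine

/-! ### Zero counts as finite sums of local orders -/

theorem LeadsAt.zeroMultiplicity_eq {F : ℂ → ℂ} {z c : ℂ} {n : ℤ} (h : LeadsAt F z n c) :
    zeroMultiplicity F z = (n.toNat : ℕ∞) := by
  rw [zeroMultiplicity, h.order]
  rfl

theorem zeroCount_eq_sum {X : Set ℂ} {f : ℂ → ℂ} (F : Finset ℂ) (μ : ℂ → ℕ) (hF : (F : Set ℂ) ⊆ X)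
    (h1 : ∀ z ∈ F, zeroMultiplicity f z = μ z)
    (h2 : ∀ z ∈ X, z ∉ F → zeroMultiplicity f z = 0) :
    zeroCount X f = ((∑ z ∈ F, μ z : ℕ) : ℕ∞) := by
  have h3 : ((∑ z ∈ F, μ z : ℕ) : ℕ∞) = ∑ z ∈ F, zeroMultiplicity f z := by
    rw [Nat.cast_sum]
    exact Finset.sum_congr rfl fun z hz => (h1 z hz).symm
  rw [h3]
  refine le_antisymm (iSup_le fun s => ?_)
    (le_iSup (fun s : {s : Finset ℂ // (s : Set ℂ) ⊆ X} => ∑ z ∈ s.1, zeroMultiplicity f z) ⟨F, hF⟩)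
  exact Finset.sum_le_sum_of_ne_zero fun z hz hne => by
    by_contra hzF
    exact hne (h2 z (s.2 hz) hzF)

section Counts

variable {f : ℂ → ℂ}

theorem zeroMultiplicity_entire (hf : Differentiable ℂ f) (h0 : f ≠ 0) (z : ℂ) :
    zeroMultiplicity f z = (analyticOrderNatAt f z : ℕ∞) := by
  obtain ⟨c, hc⟩ := leadsAt_analyticOrderNatAt hf h0 z
  rw [hc.zeroMultiplicity_eq, Int.toNat_natCast]

theorem zeroMultiplicity_Q_eq_zero (hf : Differentiable ℂ f) (h0 : f ≠ 0) {z : ℂ}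
    (h : f z ≠ 0 → logDerivDeriv f z ≠ 0) : zeroMultiplicity (logDerivDeriv f) z = 0 := by
  by_cases hz : f z = 0
  · rw [(leadsAt_Q_of_zero hf h0 hz).zeroMultiplicity_eq]
    rfl
  · rw [(LeadsAt.of_analyticAt (logDerivDeriv_analyticAt hf hz) (h hz)).zeroMultiplicity_eq]
    rfl

theorem realZeroCount_Q (hf : Differentiable ℂ f) {z₀ : ℂ} (hz₀ : f z₀ ≠ 0)
    (hQ : logDerivDeriv f z₀ ≠ 0) (S : Finset ℝ)
    (hS : ∀ x : ℝ, x ∉ S → f x ≠ 0 → logDerivDeriv f x ≠ 0) :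
    realZeroCount (logDerivDeriv f) = ((∑ x ∈ S, (ordQ f x).toNat : ℕ) : ℕ∞) := by
  classical
  have h0 : f ≠ 0 := fun h => hz₀ (by rw [h]; rfl)
  have h := zeroCount_eq_sum (X := {z | z.im = 0}) (f := logDerivDeriv f)
    (S.image (fun x : ℝ => (x : ℂ))) (fun z => (ordQ f z).toNat) ?_ ?_ ?_
  · rw [Finset.sum_image (fun x _ y _ hxy => Complex.ofReal_injective hxy)] at h
    exact h
  · intro z hz
    obtain ⟨x, -, rfl⟩ := Finset.mem_image.1 hz
    exact Complex.ofReal_im x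
  · intro z _
    obtain ⟨c, hc⟩ := leadsAt_ordQ hf hz₀ hQ z
    exact hc.zeroMultiplicity_eq
  · intro z hz hzS
    obtain ⟨x, rfl⟩ : ∃ x : ℝ, z = x := ⟨z.re, Complex.ext rfl (by simpa using hz)⟩
    exact zeroMultiplicity_Q_eq_zero hf h0
      (hS x fun hx => hzS (Finset.mem_image.2 ⟨x, hx, rfl⟩))

theorem LeadsAt.conj {F : ℂ → ℂ} (hs : ConjSymm F) {z c : ℂ} {n : ℤ} (h : LeadsAt F z n c) :
    LeadsAt F (conj z) n (conj c) := by
  obtain ⟨hc, g, hg, hgz, hFg⟩ := h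
  have hcont : Tendsto (fun w : ℂ => (starRingEnd ℂ) w) (𝓝 ((starRingEnd ℂ) z)) (𝓝 z) := by
    simpa using Complex.continuous_conj.tendsto ((starRingEnd ℂ) z)
  refine ⟨by simpa using hc, fun w => (starRingEnd ℂ) (g ((starRingEnd ℂ) w)), ?_, by simp [hgz], ?_⟩
  · rw [Complex.analyticAt_iff_eventually_differentiableAt] at hg ⊢
    filter_upwards [hcont.eventually hg] with w hw
    exact differentiableAt_conj_conj_iff.2 hw
  · have hcont' : Tendsto (fun w : ℂ => (starRingEnd ℂ) w) (𝓝[≠] ((starRingEnd ℂ) z)) (𝓝[≠] z) := by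
      refine tendsto_nhdsWithin_of_tendsto_nhds_of_eventually_within _
        (hcont.mono_left nhdsWithin_le_nhds) ?_
      filter_upwards [self_mem_nhdsWithin] with w hw hwz
      exact hw (by rw [← (hwz : (starRingEnd ℂ) w = z)]; simp)
    filter_upwards [hcont'.eventually hFg] with w hw
    have h1 := hs ((starRingEnd ℂ) w)
    rw [Complex.conj_conj] at h1
    rw [h1, hw]
    simp

theorem analyticOrderNatAt_conj (hf : Differentiable ℂ f) (hs : ConjSymm f) (h0 : f ≠ 0) (z : ℂ) :
    analyticOrderNatAt f (conj z) = analyticOrderNatAt f z := by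
  obtain ⟨c, hc⟩ := leadsAt_analyticOrderNatAt hf h0 z
  obtain ⟨d, hd⟩ := leadsAt_analyticOrderNatAt hf h0 (conj z)
  exact_mod_cast hd.order_unique (hc.conj hs)

theorem UpperNonpos.ne_zero_of_im_ne_zero {r : ℝ} (h : UpperNonpos r f) (hf : Differentiable ℂ f)
    (hs : ConjSymm f) (h0 : f ≠ 0) {z : ℂ} (hz : z.im ≠ 0) (hr : r < ‖z‖) : f z ≠ 0 := by
  rcases lt_or_gt_of_ne hz with h1 | h1
  · have h2 := h.ne_zero_of_im_pos hf h0 (z := conj z) (by rw [Complex.conj_im]; linarith)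
      (by rwa [Complex.norm_conj])
    intro h3
    exact h2 (by rw [hs, h3, map_zero])
  · exact h.ne_zero_of_im_pos hf h0 h1 hr

/-- The count of nonreal zeros by a finite set containing all zeros in the disc. -/
theorem nonrealZeroCount_eq_sum {r R : ℝ} (h : UpperNonpos r f) (hf : Differentiable ℂ f)
    (hs : ConjSymm f) (h0 : f ≠ 0) (hrR : r < R) (Z : Finset ℂ)
    (hZ : ∀ z ∈ Metric.closedBall (0 : ℂ) R, z ∉ Z → f z ≠ 0) :
    nonrealZeroCount f = ((∑ z ∈ Z with z.im ≠ 0, analyticOrderNatAt f z : ℕ) : ℕ∞) := by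
  refine zeroCount_eq_sum _ _ (fun z hz => (Finset.mem_filter.1 hz).2)
    (fun z _ => zeroMultiplicity_entire hf h0 z) fun z hz hzZ => ?_
  have hne : f z ≠ 0 := by
    by_cases hzR : ‖z‖ ≤ R
    · exact hZ z (by simpa using hzR) fun h => hzZ (Finset.mem_filter.2 ⟨h, hz⟩)
    · exact h.ne_zero_of_im_ne_zero hf hs h0 hz (hrR.trans (not_le.1 hzR))
  rw [zeroMultiplicity_entire hf h0, analyticOrderNatAt_eq_zero_of hf hne]
  rfl

/-- Conjugation matches upper and lower zeros with their orders. This is why the count for φ' is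
even. -/
theorem even_sum_nonreal (hf : Differentiable ℂ f) (hs : ConjSymm f) (h0 : f ≠ 0) (Z : Finset ℂ)
    (hZ : ∀ z ∈ Z, conj z ∈ Z) :
    ∑ z ∈ Z with z.im ≠ 0, analyticOrderNatAt f z =
      2 * ∑ z ∈ Z with 0 < z.im, analyticOrderNatAt f z := by
  classical
  have h1 : Z.filter (fun z => z.im ≠ 0) =
      Z.filter (fun z => 0 < z.im) ∪ Z.filter (fun z => z.im < 0) := by
    ext z
    simp only [Finset.mem_filter, Finset.mem_union, ← and_or_left, ne_iff_lt_or_gt]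
    tauto
  have h2 : Disjoint (Z.filter (fun z => 0 < z.im)) (Z.filter (fun z => z.im < 0)) :=
    Finset.disjoint_filter.2 fun z _ h => h.not_gt
  have h3 : ∑ z ∈ Z with z.im < 0, analyticOrderNatAt f z =
      ∑ z ∈ Z with 0 < z.im, analyticOrderNatAt f z := by
    refine Finset.sum_nbij' (fun z => conj z) (fun z => conj z) ?_ ?_ (by simp) (by simp)
      fun z _ => (analyticOrderNatAt_conj hf hs h0 z).symm
    · intro z hz
      obtain ⟨h4, h5⟩ := Finset.mem_filter.1 hz
      exact Finset.mem_filter.2 ⟨hZ z h4, by rw [Complex.conj_im]; linarith⟩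
    · intro z hz
      obtain ⟨h4, h5⟩ := Finset.mem_filter.1 hz
      exact Finset.mem_filter.2 ⟨hZ z h4, by rw [Complex.conj_im]; linarith⟩
  rw [h1, Finset.sum_union h2, h3, two_mul]

theorem eventually_ne_zero_nhdsNE (hf : Differentiable ℂ f) (h0 : f ≠ 0) (z : ℂ) :
    ∀ᶠ w in 𝓝[≠] z, f w ≠ 0 :=
  (leadsAt_analyticOrderNatAt hf h0 z).choose_spec.eventually_ne_zero

/-- The balance of the real zeros of `f` and `f'` in `(-R, R)`. -/
theorem exists_sum_orders_real (hf : Differentiable ℂ f) (hs : ConjSymm f)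
    (hexp : ¬ IsPureExponential f) {r R : ℝ} (hup : UpperNonpos r f)
    (hup' : UpperNonpos r (deriv f)) (hR0 : 0 < R) (hrR : r < R)
    (hR : ∀ y : ℝ, y = R ∨ y = -R → f y ≠ 0 ∧ deriv f y ≠ 0) {m : ℕ}
    (hm : nonrealZeroCount f = 2 * (m : ℕ∞)) :
    ∃ m₁ : ℕ, nonrealZeroCount (deriv f) = 2 * (m₁ : ℕ∞) ∧
      ∀ S : Finset ℝ, (∀ x ∈ Set.Icc (-R) R, x ∉ S → f (x : ℝ) ≠ 0 ∧ deriv f x ≠ 0) →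
        (∀ x ∈ S, x ∈ Set.Ioo (-R) R) →
        ∑ x ∈ S, ((analyticOrderNatAt (deriv f) x : ℤ) - analyticOrderNatAt f x) =
          2 * m - 2 * m₁ +
            (posInd (fun z => deriv f z / f z) (-R) - posInd (fun z => deriv f z / f z) R) := by
  classical
  have hf' := deriv_entire hf
  have h0 : f ≠ 0 := fun h => (hR R (Or.inl rfl)).1 (by rw [h]; rfl)
  have h0' : deriv f ≠ 0 := fun h => (hR R (Or.inl rfl)).2 (by rw [h]; rfl)
  -- One finite set for f and f' together, so that orders can be subtracted point by point; points
  -- where an order is 0 are harmless.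
  have hfin : (Metric.closedBall (0 : ℂ) R ∩ {z | f z = 0 ∨ deriv f z = 0}).Finite := by
    refine finite_inter_of_eventually (isCompact_closedBall 0 R) fun z => ?_
    filter_upwards [eventually_ne_zero_nhdsNE hf h0 z, eventually_ne_zero_nhdsNE hf' h0' z]
      with w h1 h2 h3
    exact h3.elim h1 h2
  set Z : Finset ℂ := hfin.toFinset with hZdef
  have hmemZ : ∀ z, z ∈ Z ↔ ‖z‖ ≤ R ∧ (f z = 0 ∨ deriv f z = 0) := fun z => by
    rw [hZdef, Set.Finite.mem_toFinset]
    simp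
  have hne : ∀ z ∈ Metric.closedBall (0 : ℂ) R, z ∉ Z → f z ≠ 0 := fun z hz hzZ h =>
    hzZ ((hmemZ z).2 ⟨by simpa using hz, Or.inl h⟩)
  have hne' : ∀ z ∈ Metric.closedBall (0 : ℂ) R, z ∉ Z → deriv f z ≠ 0 := fun z hz hzZ h =>
    hzZ ((hmemZ z).2 ⟨by simpa using hz, Or.inr h⟩)
  have hZball : ∀ z ∈ Z, z ∈ Metric.ball (0 : ℂ) R := by
    intro z hz
    obtain ⟨h1, h2⟩ := (hmemZ z).1 hz
    rw [mem_ball_zero_iff]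
    refine lt_of_le_of_ne h1 fun h3 => ?_
    by_cases h4 : z.im = 0
    · obtain ⟨x, rfl⟩ : ∃ x : ℝ, z = x := ⟨z.re, Complex.ext rfl (by simpa using h4)⟩
      rw [Complex.norm_real, Real.norm_eq_abs, abs_eq hR0.le] at h3
      have := hR x h3
      exact h2.elim this.1 this.2
    · exact h2.elim (hup.ne_zero_of_im_ne_zero hf hs h0 h4 (h3 ▸ hrR))
        (hup'.ne_zero_of_im_ne_zero hf' hs.deriv h0' h4 (h3 ▸ hrR))
  have hconj : ∀ z ∈ Z, conj z ∈ Z := by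
    intro z hz
    rw [hmemZ] at hz ⊢
    rw [Complex.norm_conj, hs, hs.deriv]
    simpa using hz
  have hc := nonrealZeroCount_eq_sum hup hf hs h0 hrR Z hne
  have hc' := nonrealZeroCount_eq_sum hup' hf' hs.deriv h0' hrR Z hne'
  have hmsum : ∑ z ∈ Z with z.im ≠ 0, analyticOrderNatAt f z = 2 * m := by
    rw [hm] at hc
    exact_mod_cast hc.symm
  have hm1 := even_sum_nonreal hf' hs.deriv h0' Z hconj
  refine ⟨∑ z ∈ Z with 0 < z.im, analyticOrderNatAt (deriv f) z, ?_, fun S hoff hS => ?_⟩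
  · rw [hc', hm1]
    push_cast
    rfl
  set m₁ := ∑ z ∈ Z with 0 < z.im, analyticOrderNatAt (deriv f) z with hm1def
  have key := sum_orders_sub hf hs hR0 (analyticOrderNatAt f) (analyticOrderNatAt (deriv f)) Z
    (fun z hz => ⟨hZball z hz, leadsAt_analyticOrderNatAt hf h0 z,
      leadsAt_analyticOrderNatAt hf' h0' z⟩) hne hne' (fun z hz him => by
        rw [mem_sphere_zero_iff_norm] at hz
        exact hup.im_neg hf hs hexp him (hz ▸ hrR)
          (hup.ne_zero_of_im_pos hf h0 him (hz ▸ hrR)))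
  -- The nonreal part is 2m₁ - 2m; the rest is the balance of real zeros.
  rw [← Finset.sum_filter_add_sum_filter_not Z (fun z => z.im ≠ 0)] at key
  have h1 : ∑ z ∈ Z with z.im ≠ 0,
      ((analyticOrderNatAt (deriv f) z : ℤ) - analyticOrderNatAt f z) = 2 * m₁ - 2 * m := by
    rw [Finset.sum_sub_distrib]
    have e1 : ((∑ z ∈ Z with z.im ≠ 0, analyticOrderNatAt f z : ℕ) : ℤ) = 2 * m := by
      exact_mod_cast hmsum
    have e2 : ((∑ z ∈ Z with z.im ≠ 0, analyticOrderNatAt (deriv f) z : ℕ) : ℤ) = 2 * m₁ := by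
      exact_mod_cast hm1
    rw [← e1, ← e2]
    push_cast
    ring
  have h2 : ∑ z ∈ Z with ¬ z.im ≠ 0,
      ((analyticOrderNatAt (deriv f) z : ℤ) - analyticOrderNatAt f z) =
      ∑ x ∈ S, ((analyticOrderNatAt (deriv f) x : ℤ) - analyticOrderNatAt f x) := by
    have e1 : ∑ x ∈ S, ((analyticOrderNatAt (deriv f) x : ℤ) - analyticOrderNatAt f x) =
        ∑ z ∈ S.image (fun x : ℝ => (x : ℂ)),
          ((analyticOrderNatAt (deriv f) z : ℤ) - analyticOrderNatAt f z) := by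
      rw [Finset.sum_image (fun x _ y _ hxy => Complex.ofReal_injective hxy)]
    rw [e1]
    refine Finset.sum_subset ?_ ?_
    · intro z hz
      obtain ⟨h3, h4⟩ := Finset.mem_filter.1 hz
      obtain ⟨x, rfl⟩ : ∃ x : ℝ, z = x :=
        ⟨z.re, Complex.ext rfl (by simpa using (not_not.1 h4))⟩
      refine Finset.mem_image.2 ⟨x, ?_, rfl⟩
      by_contra hxS
      obtain ⟨h5, h6⟩ := (hmemZ _).1 h3
      rw [Complex.norm_real, Real.norm_eq_abs] at h5
      have := hoff x (abs_le.1 h5) hxS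
      exact h6.elim this.1 this.2
    · intro z hz hzZ
      obtain ⟨x, hx, rfl⟩ := Finset.mem_image.1 hz
      have hxb : (x : ℂ) ∈ Metric.closedBall (0 : ℂ) R := by
        rw [mem_closedBall_zero_iff, Complex.norm_real, Real.norm_eq_abs]
        exact abs_le.2 ⟨(hS x hx).1.le, (hS x hx).2.le⟩
      have hxZ : (x : ℂ) ∉ Z := fun h => hzZ (Finset.mem_filter.2 ⟨h, by simp⟩)
      rw [analyticOrderNatAt_eq_zero_of hf (hne _ hxb hxZ),
        analyticOrderNatAt_eq_zero_of hf' (hne' _ hxb hxZ)]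
      simp
  rw [h1, h2] at key
  linarith

end Counts

/-! ### The main theorem -/

theorem eventually_Q_ne_zero {f : ℂ → ℂ} (hf : Differentiable ℂ f) {z₀ : ℂ} (hz₀ : f z₀ ≠ 0)
    (hQ : logDerivDeriv f z₀ ≠ 0) (x : ℝ) : ∀ᶠ y : ℝ in 𝓝[≠] x, logDerivDeriv f y ≠ 0 :=
  (tendsto_ofReal_nhdsNE x).eventually (leadsAt_ordQ hf hz₀ hQ x).choose_spec.eventually_ne_zero

theorem realZeroCount_eq_top_of_eq_zero {F : ℂ → ℂ} (h : ∀ z, F z = 0) :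
    realZeroCount F = ⊤ := by
  have h1 : zeroMultiplicity F 0 = ⊤ := by
    rw [zeroMultiplicity, meromorphicOrderAt_eq_top_iff.2 (Eventually.of_forall h)]
    rfl
  refine top_le_iff.1 (le_trans ?_ (le_iSup
    (fun s : {s : Finset ℂ // (s : Set ℂ) ⊆ {z | z.im = 0}} => ∑ z ∈ s.1, zeroMultiplicity F z)
    ⟨{0}, by simp⟩))
  simp [h1]

theorem IsPureExponential.logDerivDeriv_eq_zero {f : ℂ → ℂ} (h : IsPureExponential f) (h0 : f ≠ 0) (z : ℂ) :
    logDerivDeriv f z = 0 := by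
  obtain ⟨C, β, h⟩ := h
  have hC : (C : ℂ) ≠ 0 := fun hC => h0 (funext fun z => by simp [h, hC])
  have h1 : ∀ z, HasDerivAt f ((C : ℂ) * (Complex.exp (β * z) * (β * 1))) z := fun z => by
    rw [funext h]
    exact (((hasDerivAt_id' z).const_mul (β : ℂ)).cexp).const_mul (C : ℂ)
  have h2 : (fun z => deriv f z / f z) = fun _ => (β : ℂ) := funext fun z => by
    rw [(h1 z).deriv, h]
    have := Complex.exp_ne_zero (β * z)
    field_simp
  rw [logDerivDeriv, h2, deriv_const]

theorem mainTheorem2 (φ : ℂ → ℂ) (hφ : φ ∈ LaguerrePolyaStar) (hexp : ¬ IsPureExponential φ)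
    (m : ℕ) (hm : nonrealZeroCount φ = 2 * (m : ℕ∞)) (hA : HasPropertyA φ) :
    ∃ m₁ N : ℕ,
      nonrealZeroCount (deriv φ) = 2 * (m₁ : ℕ∞) ∧
      realZeroCount (logDerivDeriv φ) = (N : ℕ∞) ∧
      (¬ IsPureExponential (deriv φ) → realZeroCount (logDerivDeriv (deriv φ)) ≠ ⊤) ∧
      2 * (m : ℤ) - 2 * (m₁ : ℤ) ≤ (N : ℤ) ∧
      (N : ℕ∞) + 2 * (m₁ : ℕ∞) ≤ 2 * (m : ℕ∞) + realZeroCount (logDerivDeriv (deriv φ)) := by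
  classical
  have h0 : φ ≠ 0 := fun h => hexp ⟨0, 0, fun z => by simp [h]⟩
  obtain ⟨hf, hs, r, hup, hup'⟩ := laguerrePolyaStar_properties hφ h0
  have hf' := deriv_entire hf
  have h0' : deriv φ ≠ 0 := fun h => hexp (isPureExponential_of_eventually hf hs (z := 0) (k := 0)
    (Eventually.of_forall fun w => by simp [h]))
  -- Only finitely many absolute values of real zeros of φ and φ' lie in a bounded interval beyond
  -- r, so some R there avoids them.
  obtain ⟨R, hR0, hrR, hR⟩ : ∃ R : ℝ, 0 < R ∧ r < R ∧
      ∀ y : ℝ, y = R ∨ y = -R → φ y ≠ 0 ∧ deriv φ y ≠ 0 := by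
    set ρ := max r 0 with hρ
    have hfin : (Set.Icc (-(ρ + 2)) (ρ + 2) ∩ {y : ℝ | φ y = 0 ∨ deriv φ y = 0}).Finite :=
      finite_inter_of_eventually isCompact_Icc fun x => by
        filter_upwards [eventually_ne_zero_real hf h0 x, eventually_ne_zero_real hf' h0' x]
          with y h1 h2 h3
        exact h3.elim h1 h2
    have hinf : (Set.Ioo (ρ + 1) (ρ + 2)).Infinite := Set.Ioo_infinite (by linarith)
    obtain ⟨R, hR, hRn⟩ := (hinf.sdiff (hfin.image fun y => |y|)).nonempty
    have hρ0 : 0 ≤ ρ := le_max_right _ _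
    have hρr : r ≤ ρ := le_max_left _ _
    have hRpos : 0 < R := by linarith [hR.1]
    refine ⟨R, hRpos, by linarith [hR.1], fun y hy => ?_⟩
    have habs : |y| = R := by
      rcases hy with rfl | rfl
      · exact abs_of_pos hRpos
      · rw [abs_neg, abs_of_pos hRpos]
    have hmem : y ∈ Set.Icc (-(ρ + 2)) (ρ + 2) := abs_le.1 (by rw [habs]; exact hR.2.le)
    exact ⟨fun h => hRn ⟨y, ⟨hmem, Or.inl h⟩, habs⟩, fun h => hRn ⟨y, ⟨hmem, Or.inr h⟩, habs⟩⟩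
  have hnorm : ∀ x : ℝ, R ≤ |x| → r < ‖(x : ℂ)‖ := fun x hx => by
    rw [Complex.norm_real, Real.norm_eq_abs]
    linarith
  have hRabs : ∀ y : ℝ, y = R ∨ y = -R → R ≤ |y| := fun y hy => by
    rcases hy with rfl | rfl
    · exact le_abs_self _
    · rw [abs_neg]; exact le_abs_self _
  have hQR : ∀ y : ℝ, y = R ∨ y = -R → (logDerivDeriv φ y).re < 0 := fun y hy =>
    hup.deriv_logDeriv_neg hf hs hexp (hnorm y (hRabs y hy)) (hR y hy).1
  have hne_of_re : ∀ {w : ℂ}, w.re < 0 → w ≠ 0 := fun h hw => by rw [hw] at h; simp at h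
  have hRR := hR R (Or.inl rfl)
  have hQRR : logDerivDeriv φ R ≠ 0 := hne_of_re (hQR R (Or.inl rfl))
  have hout : ∀ x : ℝ, x ∉ Set.Icc (-R) R → φ x ≠ 0 → logDerivDeriv φ x ≠ 0 := fun x hx hφx =>
    hne_of_re (hup.deriv_logDeriv_neg hf hs hexp
      (hnorm x (not_le.1 fun h => hx (abs_le.1 h)).le) hφx)
  have hioo : ∀ x ∈ Set.Icc (-R) R, x ≠ R → x ≠ -R → x ∈ Set.Ioo (-R) R := fun x hx h1 h2 =>
    ⟨lt_of_le_of_ne hx.1 (Ne.symm h2), lt_of_le_of_ne hx.2 h1⟩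
  obtain ⟨m₁, hm₁, horders⟩ := exists_sum_orders_real hf hs hexp hup hup' hR0 hrR hR hm
  -- the special points for the lower bound
  have hfinS : (Set.Icc (-R) R ∩ {y : ℝ | φ y = 0 ∨ deriv φ y = 0 ∨ logDerivDeriv φ y = 0}).Finite :=
    finite_inter_of_eventually isCompact_Icc fun x => by
      filter_upwards [eventually_ne_zero_real hf h0 x, eventually_ne_zero_real hf' h0' x,
        eventually_Q_ne_zero hf hRR.1 hQRR x] with y h1 h2 h3 h4
      rcases h4 with h4 | h4 | h4
      exacts [h1 h4, h2 h4, h3 h4]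
  set S : Finset ℝ := hfinS.toFinset with hSdef
  have hSmem : ∀ x, x ∈ S ↔ x ∈ Set.Icc (-R) R ∧ (φ x = 0 ∨ deriv φ x = 0 ∨ logDerivDeriv φ x = 0) :=
    fun x => by rw [hSdef, Set.Finite.mem_toFinset]; rfl
  have hSioo : ∀ x ∈ S, x ∈ Set.Ioo (-R) R := by
    intro x hx
    obtain ⟨h1, h2⟩ := (hSmem x).1 hx
    have hno : ¬ (x = R ∨ x = -R) := fun h => by
      rcases h2 with h2 | h2 | h2
      exacts [(hR x h).1 h2, (hR x h).2 h2, hne_of_re (hQR x h) h2]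
    exact hioo x h1 (fun h => hno (Or.inl h)) fun h => hno (Or.inr h)
  have hSoff : ∀ x ∈ Set.Icc (-R) R, x ∉ S →
      φ (x : ℝ) ≠ 0 ∧ deriv φ x ≠ 0 ∧ logDerivDeriv φ x ≠ 0 := fun x hx hxS =>
    ⟨fun h => hxS ((hSmem x).2 ⟨hx, Or.inl h⟩), fun h => hxS ((hSmem x).2 ⟨hx, Or.inr (Or.inl h)⟩),
      fun h => hxS ((hSmem x).2 ⟨hx, Or.inr (Or.inr h)⟩)⟩
  have hN := realZeroCount_Q hf hRR.1 hQRR S fun x hxS hφx => by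
    by_cases hx : x ∈ Set.Icc (-R) R
    · exact (hSoff x hx hxS).2.2
    · exact hout x hx hφx
  set N := ∑ x ∈ S, (ordQ φ x).toNat with hNdef
  have hlow := sum_order_sub_le hf hs hR0 (fun y hy => ⟨(hR y hy).1, (hR y hy).2, hQR y hy⟩)
    hSioo hSoff
  rw [Finset.sum_sub_distrib, horders S (fun x hx hxS => ⟨(hSoff x hx hxS).1, (hSoff x hx hxS).2.1⟩)
    hSioo] at hlow
  have hNcast : (N : ℤ) = ∑ x ∈ S, ((ordQ φ x).toNat : ℤ) := by rw [hNdef]; push_cast; rfl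
  have hlower : 2 * (m : ℤ) - 2 * (m₁ : ℤ) ≤ (N : ℤ) := by rw [hNcast]; linarith
  by_cases hexp' : IsPureExponential (deriv φ)
  · refine ⟨m₁, N, hm₁, hN, fun h => absurd hexp' h, hlower, ?_⟩
    -- Here Q₁ vanishes identically, counts infinitely many zeros, and makes the upper bound
    -- trivial.
    rw [realZeroCount_eq_top_of_eq_zero (hexp'.logDerivDeriv_eq_zero h0')]
    simp
  -- the special points for the upper bound
  have hQR' : ∀ y : ℝ, y = R ∨ y = -R → (logDerivDeriv (deriv φ) y).re < 0 := fun y hy =>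
    hup'.deriv_logDeriv_neg hf' hs.deriv hexp' (hnorm y (hRabs y hy)) (hR y hy).2
  have hQRR' : logDerivDeriv (deriv φ) R ≠ 0 := hne_of_re (hQR' R (Or.inl rfl))
  have hfinT : (Set.Icc (-R) R ∩ {y : ℝ | logDerivDeriv (deriv φ) y = 0}).Finite :=
    finite_inter_of_eventually isCompact_Icc fun x => eventually_Q_ne_zero hf' hRR.2 hQRR' x
  set T : Finset ℝ := S ∪ hfinT.toFinset with hTdef
  have hTioo : ∀ x ∈ T, x ∈ Set.Ioo (-R) R := by
    intro x hx
    rcases Finset.mem_union.1 hx with h | h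
    · exact hSioo x h
    · obtain ⟨h1, h2⟩ := (Set.Finite.mem_toFinset hfinT).1 h
      have hno : ¬ (x = R ∨ x = -R) := fun h => hne_of_re (hQR' x h) h2
      exact hioo x h1 (fun h => hno (Or.inl h)) fun h => hno (Or.inr h)
  have hToff : ∀ x ∈ Set.Icc (-R) R, x ∉ T → φ (x : ℝ) ≠ 0 ∧ deriv φ x ≠ 0 ∧
      logDerivDeriv φ x ≠ 0 ∧ logDerivDeriv (deriv φ) x ≠ 0 := fun x hx hxT => by
    have h1 := hSoff x hx fun h => hxT (Finset.mem_union_left _ h)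
    exact ⟨h1.1, h1.2.1, h1.2.2, fun h => hxT (Finset.mem_union_right _
      ((Set.Finite.mem_toFinset hfinT).2 ⟨hx, h⟩))⟩
  have hNT := realZeroCount_Q hf hRR.1 hQRR T fun x hxT hφx => by
    by_cases hx : x ∈ Set.Icc (-R) R
    · exact (hToff x hx hxT).2.2.1
    · exact hout x hx hφx
  have hNT' := realZeroCount_Q hf' hRR.2 hQRR' T fun x hxT hφx => by
    by_cases hx : x ∈ Set.Icc (-R) R
    · exact (hToff x hx hxT).2.2.2
    · exact hne_of_re (hup'.deriv_logDeriv_neg hf' hs.deriv hexp'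
        (hnorm x (not_le.1 fun h => hx (abs_le.1 h)).le) hφx)
  -- Enlarging S by the zeros of Q₁ does not change the count of zeros of Q, since both sums compute
  -- it.
  have hNeq : (N : ℤ) = ∑ x ∈ T, ((ordQ φ x).toNat : ℤ) := by
    have h1 : N = ∑ x ∈ T, (ordQ φ x).toNat := by
      rw [hN] at hNT
      exact_mod_cast hNT
    rw [h1]; push_cast; rfl
  have hupp := sum_ordQ_sub_le hf hs hR0
    (fun y hy => ⟨(hR y hy).1, (hR y hy).2, hQR y hy, hQR' y hy⟩) hTioo hToff hA
  rw [Finset.sum_sub_distrib, Finset.sum_sub_distrib, ← hNeq,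
    horders T (fun x hx hxT => ⟨(hToff x hx hxT).1, (hToff x hx hxT).2.1⟩) hTioo] at hupp
  refine ⟨m₁, N, hm₁, hN, fun _ => by rw [hNT']; exact ENat.natCast_ne_top _, hlower, ?_⟩
  rw [hNT']
  have h2 : N + 2 * m₁ ≤ 2 * m + ∑ x ∈ T, (ordQ (deriv φ) x).toNat := by
    zify
    linarith
  exact_mod_cast h2
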